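/- Graphs are undirected, without multiple edges; loops are allowed unless excluded. For graphs $T$ (finite) and $G$, let $\mathrm{Hom}(T,G)$ be the polyhedral complex whose cells $\prod_{x\in V(T)}\eta(x)$ (products of simplices) are indexed by the functions $\eta$ from $V(T)$ to the finite non-empty subsets of $V(G)$ with $\eta(x)\times\eta(y)\subseteq E(G)$ for every $(x,y)\in E(T)$, the closure of $\eta$ consisting of all $\tilde\eta$ with $\tilde\eta(x)\subseteq\eta(x)$ for all $x$; its vertices are the graph homomorphisms $T\to G$. Let $r\ge 1$, let $C_{2r+1}$ be the cycle with vertex set $\mathbb Z/(2r+1)$, and let $K_3$ be the complete graph on $3$ vertices. Fix a reflection $x\mapsto c-x$ of $C_{2r+1}$. For every graph $G$ without loops it induces a fixed point free involution of $\mathrm{Hom}(C_{2r+1},G)$, which makes this complex a $\mathbb Z_2$-space. For a $\mathbb Z_2$-space $X$, a CW complex with a fixed point free involution, $\varpi_1(X)\in H^1(X/\mathbb Z_2;\mathbb Z_2)$ denotes the pull-back of the non-trivial class of $H^1(\mathbb{RP}^\infty;\mathbb Z_2)$ under the map $X/\mathbb Z_2\to\mathbb{RP}^\infty$ induced by any $\mathbb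 Z_2$-map $X\to S^\infty$. The winding number of a homomorphism $C_{2r+1}\to K_3$ is that of the map of circles $|C_{2r+1}|\to|K_3|$ which extends it affinely on edges, with $K_3$ oriented cyclically. Then the following hold. 1. There is a continuous (that is, locally constant) function $W:\mathrm{Hom}(C_{2r+1},K_3)\to\mathbb Z$ whose value at every vertex is the winding number of the corresponding homomorphism. Its image is the set $\{\pm1,\pm3,\dots,\pm(2s+1)\}$, where $s=\lfloor (r-1)/3\rfloor$. For every $\alpha$ in this set with $3|\alpha|<2r+1$, the set $W^{-1}(\alpha)$ is a single connected component. If $3|\alpha|=2r+1$ (which occurs only if $3$ divides $2r+1$), then $W^{-1}(\alpha)$ consists of exactly three points, each of which is a connected component. 2. The $\mathbb Z_2$-action negates $W$. In particular, it maps every connected component of $\mathrm{Hom}(C_{2r+1},K_3)$ to a different one. 3. $\mathrm{Hom}(C_{2r+1},K_3)$ admits a $\mathbb Z_2$-map to $S^\infty$, and $\varpi_1(\mathrm{Hom}(C_{2r+1},K_3))=0$. 4. If $G$ is a graph without loops (finite or infinite) such that $\varpi_1(\mathrm{Hom}(C_{2r+1},G))\ne 0$, then $\chi(G)\ge 4$.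 5. If $G$ is a graph such that $\mathrm{Hom}(C_{2r+1},G)$ is connected (in particular non-empty), then $\chi(G)\ge 4$. Here $\chi(G)=\infty$ if $G$ has no colouring with finitely many colours, for instance if $G$ has a loop. -/

import Mathlib

open Topology

noncomputable section

/-! ### Graphs with loops allowed -/

/-- An undirected graph without multiple edges; loops are allowed. -/
structure LoopGraph (V : Type*) where
  Adj : V → V → Prop
  symm : ∀ x y, Adj x y → Adj y x

namespace LoopGraph

variable {U V : Type*}

def Loopless (G : LoopGraph V) : Prop := ∀ x, ¬ G.Adj x x

/-- Graph homomorphisms. -/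
def Homs (T : LoopGraph U) (G : LoopGraph V) : Type _ :=
  {φ : U → V // ∀ x y, T.Adj x y → G.Adj (φ x) (φ y)}

/-- The least size of a colour set of a vertex-colouring, `⊤` if there is no finite one. -/
def chromaticNumber (G : LoopGraph V) : ℕ∞ :=
  ⨅ n ∈ {n : ℕ | ∃ f : V → Fin n, ∀ x y, G.Adj x y → f x ≠ f y}, (n : ℕ∞)

/-- The complete graph without loops. -/
def complete (n : ℕ) : LoopGraph (Fin n) where
  Adj x y := x ≠ y
  symm _ _ h := h.symm

/-- The cycle with `m` vertices. -/
def cycle (m : ℕ) : LoopGraph (ZMod m) where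
  Adj x y := y = x + 1 ∨ x = y + 1
  symm _ _ h := h.symm

theorem complete_loopless (n : ℕ) : (complete n).Loopless := fun _ h => h rfl

end LoopGraph

/-! ### Weak topologies -/

/-- The weak topology on a set `P` of points with real coordinates indexed by `κ`, with respect to
a family of closed cells: every cell carries the topology induced from the product topology on
`κ → ℝ`, and a set is open iff its trace on every cell is open in that cell. -/
abbrev weakTopology {P κ ι : Type*} (coord : P → κ → ℝ) (cell : ι → Set P) : TopologicalSpace P :=
  ⨆ i, TopologicalSpace.coinduced (Subtype.val : cell i → P)
    (TopologicalSpace.induced (fun p : cell i => coord p) inferInstance)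

theorem weakTopology_continuous {P κ ι Q κ' ι' : Type*} (coord : P → κ → ℝ) (cell : ι → Set P)
    (coord' : Q → κ' → ℝ) (cell' : ι' → Set Q) (f : P → Q) (s : ι → ι')
    (hs : ∀ i, ∀ p ∈ cell i, f p ∈ cell' (s i)) (A : (κ → ℝ) → (κ' → ℝ)) (hA : Continuous A)
    (hf : ∀ p, coord' (f p) = A (coord p)) :
    Continuous[weakTopology coord cell, weakTopology coord' cell'] f := by
  unfold weakTopology
  rw [continuous_iSup_dom]
  intro i
  rw [continuous_coinduced_dom]
  let _ : TopologicalSpace (cell i) :=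
    TopologicalSpace.induced (fun p : cell i => coord p) inferInstance
  let _ : TopologicalSpace (cell' (s i)) :=
    TopologicalSpace.induced (fun p : cell' (s i) => coord' p) inferInstance
  refine continuous_iSup_rng (i := s i) ?_
  let _ : TopologicalSpace Q :=
    TopologicalSpace.coinduced (Subtype.val : cell' (s i) → Q) inferInstance
  have h1 : Continuous (fun p : cell i => (⟨f p, hs i p p.2⟩ : cell' (s i))) := by
    refine continuous_induced_rng.2 ?_
    have h2 : Continuous (fun p : cell i => coord p) := continuous_induced_dom
    have h3 := hA.comp h2
    have h5 : (fun p : cell i => coord' (f p)) = A ∘ (fun p : cell i => coord p) := by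
      funext p
      exact hf p
    rw [← h5] at h3
    exact h3
  have h4 : Continuous (Subtype.val : cell' (s i) → Q) := continuous_coinduced_rng
  exact h4.comp h1

/-! ### The complexes `Hom(T, G)` -/

/-- The points of `Hom(T, G)`, for a graph `T` with finitely many vertices: they are the points `p`
of the product of the simplices on the vertex set of `G`, one factor for every vertex of `T`
(each `p x` being given by its barycentric coordinates), such that the supports of `p x` and `p y`
span a complete bipartite subgraph of `G` whenever `x` and `y` are adjacent in `T`. -/
def HomComplex {U V : Type*} [Finite U] (T : LoopGraph U) (G : LoopGraph V) : Type _ :=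
  {p : U → V →₀ ℝ // (∀ x a, 0 ≤ p x a) ∧ (∀ x, (p x).sum (fun _ t => t) = 1) ∧
    ∀ x y, T.Adj x y → ∀ a ∈ (p x).support, ∀ b ∈ (p y).support, G.Adj a b}

namespace HomComplex

variable {U V : Type*} [Finite U] {T : LoopGraph U} {G : LoopGraph V}

/-- The barycentric coordinates of a point. -/
def coord (p : HomComplex T G) : U × V → ℝ := fun k => p.1 k.1 k.2

/-- The indexing set of the cells: functions `η` from the vertices of `T` to the finite non-empty
sets of vertices of `G` with `η x × η y ⊆ E(G)` for every edge `(x, y)` of `T`. -/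
def CellIndex (T : LoopGraph U) (G : LoopGraph V) : Type _ :=
  {η : U → Finset V // (∀ x, (η x).Nonempty) ∧
    ∀ x y, T.Adj x y → ∀ a ∈ η x, ∀ b ∈ η y, G.Adj a b}

/-- The closed cell with index `η`, the product of the simplices with vertex sets `η x`. -/
def closedCell (η : CellIndex T G) : Set (HomComplex T G) :=
  {p | ∀ x, (p.1 x).support ⊆ η.1 x}

instance : TopologicalSpace (HomComplex T G) := weakTopology coord closedCell

/-- The vertex of `Hom(T, G)` given by a graph homomorphism. -/
def vertex (φ : LoopGraph.Homs T G) : HomComplex T G :=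
  ⟨fun x => Finsupp.single (φ.1 x) 1, by
    refine ⟨fun x a => ?_, fun x => by simp, fun x y hxy a ha b hb => ?_⟩
    · classical
      rw [Finsupp.single_apply]
      split_ifs <;> norm_num
    · have ha' := Finsupp.support_single_subset ha
      have hb' := Finsupp.support_single_subset hb
      rw [Finset.mem_singleton] at ha' hb'
      rw [ha', hb']
      exact φ.2 x y hxy⟩

end HomComplex

/-! ### `ℤ₂`-spaces -/

/-- A fixed point free continuous involution, the action of the generator of `ℤ₂` on a
`ℤ₂`-space. -/
structure FreeInvolution (X : Type*) [TopologicalSpace X] where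
  toFun : X → X
  continuous : Continuous toFun
  involutive : ∀ x, toFun (toFun x) = x
  free : ∀ x, toFun x ≠ x

namespace FreeInvolution

variable {X Y : Type*} [TopologicalSpace X] [TopologicalSpace Y]

def orbitSetoid (τ : FreeInvolution X) : Setoid X where
  r x y := y = x ∨ y = τ.toFun x
  iseqv :=
    { refl := fun _ => Or.inl rfl
      symm := by
        rintro x y (rfl | rfl)
        · exact Or.inl rfl
        · exact Or.inr (τ.involutive x).symm
      trans := by
        rintro x y z (rfl | rfl) (rfl | rfl)
        · exact Or.inl rfl
        · exact Or.inr rfl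
        · exact Or.inr rfl
        · exact Or.inl (τ.involutive x) }

/-- The orbit space `X/ℤ₂`, with the quotient topology. -/
def OrbitSpace (τ : FreeInvolution X) : Type _ := Quotient τ.orbitSetoid

instance (τ : FreeInvolution X) : TopologicalSpace τ.OrbitSpace :=
  inferInstanceAs (TopologicalSpace (Quotient τ.orbitSetoid))

/-- `ℤ₂`-maps, i.e. equivariant continuous maps. -/
def EquivariantMap (τ : FreeInvolution X) (ρ : FreeInvolution Y) : Type _ :=
  {f : C(X, Y) // ∀ x, f (τ.toFun x) = ρ.toFun (f x)}

/-- The map of orbit spaces induced by a `ℤ₂`-map. -/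
def EquivariantMap.onOrbits {τ : FreeInvolution X} {ρ : FreeInvolution Y}
    (f : EquivariantMap τ ρ) : C(τ.OrbitSpace, ρ.OrbitSpace) where
  toFun := Quotient.map f.1 (by
    rintro x y (rfl | rfl)
    · exact Or.inl rfl
    · exact Or.inr (f.2 x))
  continuous_toFun := Continuous.quotient_map' (s := τ.orbitSetoid) (t := ρ.orbitSetoid)
    f.1.continuous _

end FreeInvolution

/-! ### Singular cohomology with coefficients in `ℤ₂` -/

namespace SingularCohomology

variable {X Y : Type*} [TopologicalSpace X] [TopologicalSpace Y]

/-- Singular `n`-simplices. -/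
abbrev Simplex (n : ℕ) (X : Type*) [TopologicalSpace X] := C(stdSimplex ℝ (Fin (n + 1)), X)

/-- The `i`-th face of a singular simplex. -/
def face {n : ℕ} (i : Fin (n + 2)) (σ : Simplex (n + 1) X) : Simplex n X :=
  σ.comp ⟨stdSimplex.map i.succAbove, stdSimplex.continuous_map _⟩

/-- Singular cochains with coefficients in `ℤ₂`. -/
abbrev Cochain (n : ℕ) (X : Type*) [TopologicalSpace X] := Simplex n X → ZMod 2

/-- The coboundary operator; signs play no role modulo 2. -/
def coboundary (n : ℕ) (X : Type*) [TopologicalSpace X] :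
    Cochain n X →ₗ[ZMod 2] Cochain (n + 1) X where
  toFun f σ := ∑ i, f (face i σ)
  map_add' f g := by
    funext σ
    simp [Finset.sum_add_distrib]
  map_smul' a f := by
    funext σ
    simp [Finset.mul_sum]

/-- The first singular cohomology group `H¹(X; ℤ₂)`, cocycles modulo coboundaries. -/
abbrev H1 (X : Type*) [TopologicalSpace X] :=
  LinearMap.ker (coboundary 1 X) ⧸
    (LinearMap.range (coboundary 0 X)).submoduleOf (LinearMap.ker (coboundary 1 X))

/-- Pull-back of cochains. -/
def pullback (n : ℕ) (f : C(X, Y)) : Cochain n Y →ₗ[ZMod 2] Cochain n X where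
  toFun u σ := u (f.comp σ)
  map_add' _ _ := rfl
  map_smul' _ _ := rfl

theorem pullback_coboundary (n : ℕ) (f : C(X, Y)) (u : Cochain n Y) :
    pullback (n + 1) f (coboundary n Y u) = coboundary n X (pullback n f u) := rfl

/-- The map `f* : H¹(Y; ℤ₂) → H¹(X; ℤ₂)` induced by a continuous map `f : X → Y`. -/
def H1map (f : C(X, Y)) : H1 Y →ₗ[ZMod 2] H1 X :=
  Submodule.mapQ _ _
    ((pullback 1 f).restrict (p := LinearMap.ker (coboundary 1 Y))
      (q := LinearMap.ker (coboundary 1 X)) (fun u hu => by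
        rw [LinearMap.mem_ker] at hu ⊢
        rw [← pullback_coboundary, hu, map_zero]))
    (by
      rintro ⟨u, hu⟩ ⟨v, hv⟩
      exact ⟨pullback 0 f v, by
        rw [← pullback_coboundary, hv]
        rfl⟩)

end SingularCohomology

/-! ### The infinite sphere and the first Stiefel-Whitney class -/

/-- The infinite dimensional sphere, the union of the unit spheres of the spaces `ℝⁿ`. -/
def InfSphere : Type := {x : ℕ →₀ ℝ // x.sum (fun _ t => t ^ 2) = 1}

namespace InfSphere

def coord (x : InfSphere) : ℕ → ℝ := fun i => x.1 i

/-- The finite dimensional subsphere where all coordinates but the first `n` vanish. -/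
def subsphere (n : ℕ) : Set InfSphere := {x | ∀ i, n ≤ i → x.1 i = 0}

/-- The topology of the union of the finite dimensional spheres. -/
instance : TopologicalSpace InfSphere := weakTopology coord subsphere

/-- The antipodal action on the infinite dimensional sphere. -/
def antipodal : FreeInvolution InfSphere where
  toFun x := ⟨-x.1, by
    have h := x.2
    rw [Finsupp.sum_neg_index (by simp)]
    simpa using h⟩
  continuous := by
    refine weakTopology_continuous _ _ _ _ _ id ?_ (fun v => -v) continuous_neg ?_
    · intro n x hx i hi
      change -(x.1 i) = 0
      rw [hx i hi, neg_zero]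
    · intro x
      rfl
  involutive x := Subtype.ext (neg_neg x.1)
  free x h := by
    have h1 : -x.1 = x.1 := congrArg Subtype.val h
    have h2 : x.1 = 0 := by
      ext i
      have h3 := DFunLike.congr_fun h1 i
      rw [Finsupp.neg_apply] at h3
      rw [Finsupp.zero_apply]
      linarith
    have h4 := x.2
    rw [h2] at h4
    simp at h4

end InfSphere

/-- Infinite dimensional real projective space. -/
abbrev InfProjectiveSpace : Type := InfSphere.antipodal.OrbitSpace

/-- The non-trivial class of `H¹(ℝP^∞; ℤ₂)` (this group has two elements). -/
def projectiveClass : SingularCohomology.H1 InfProjectiveSpace :=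
  Classical.epsilon fun z => z ≠ 0

open Classical in
/-- The first Stiefel-Whitney class of a `ℤ₂`-space `X`: the pull-back of the non-trivial class of
`H¹(ℝP^∞; ℤ₂)` under the map `X/ℤ₂ → ℝP^∞` induced by a `ℤ₂`-map from `X` to the infinite
dimensional sphere. For a CW complex `X`, such a `ℤ₂`-map exists and the class does not depend on
it. -/
def stiefelWhitney {X : Type*} [TopologicalSpace X] (τ : FreeInvolution X) :
    SingularCohomology.H1 τ.OrbitSpace :=
  if h : Nonempty (FreeInvolution.EquivariantMap τ InfSphere.antipodal) then
    SingularCohomology.H1map (Classical.choice h).onOrbits projectiveClass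
  else 0

/-! ### Odd cycles -/

namespace HomComplex

variable {V : Type*} {G : LoopGraph V}

/-- The action on `Hom(C_{2r+1}, G)`, for a loopfree graph `G`, of the reflection `x ↦ c - x` of
the cycle `C_{2r+1}`. Every reflection of the cycle is of this form. -/
def reflection (r : ℕ) (c : ZMod (2 * r + 1)) (hG : G.Loopless) :
    FreeInvolution (HomComplex (LoopGraph.cycle (2 * r + 1)) G) where
  toFun p := ⟨fun x => p.1 (c - x), fun x a => p.2.1 (c - x) a, fun x => p.2.2.1 (c - x), by
    rintro x y hxy
    refine p.2.2.2 (c - x) (c - y) ?_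
    rcases hxy with rfl | rfl
    · exact Or.inr (by ring)
    · exact Or.inl (by ring)⟩
  continuous := by
    refine weakTopology_continuous _ _ _ _ _
      (fun η => ⟨fun x => η.1 (c - x), fun x => η.2.1 (c - x), ?_⟩) ?_
      (fun v k => v (c - k.1, k.2)) (by fun_prop) ?_
    · rintro x y hxy
      refine η.2.2 (c - x) (c - y) ?_
      rcases hxy with rfl | rfl
      · exact Or.inr (by ring)
      · exact Or.inl (by ring)
    · intro η p hp x
      exact hp (c - x)
    · intro p
      rfl
  involutive p := Subtype.ext (by
    funext x
    change p.1 (c - (c - x)) = p.1 x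
    rw [sub_sub_cancel])
  free p h := by
    have h0 : (2 * (r : ZMod (2 * r + 1)) + 1) = 0 := by
      exact_mod_cast ZMod.natCast_self (2 * r + 1)
    let x : ZMod (2 * r + 1) := (c - 1) * (r + 1)
    have hx : c - x = x + 1 := by
      have : (c - 1) * (2 * (r : ZMod (2 * r + 1)) + 1) = 0 := by rw [h0, mul_zero]
      simp only [x]
      linear_combination -this
    have h1 : p.1 (c - x) = p.1 x := congrFun (congrArg Subtype.val h) x
    rw [hx] at h1
    have h2 : (p.1 x).support.Nonempty := by
      rw [Finsupp.support_nonempty_iff]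
      intro h3
      have h4 := p.2.2.1 x
      rw [h3] at h4
      simp at h4
    obtain ⟨a, ha⟩ := h2
    exact hG a (p.2.2.2 x (x + 1) (Or.inl rfl) a ha a (h1 ▸ ha))

end HomComplex

/-! ### Winding numbers -/

/-- A continuous map `f` of the circle `ℝ/ℤ` to itself has winding number `α` if it has a
continuous lift `F : ℝ → ℝ` with `F (x + 1) = F x + α`. -/
def IsWindingNumber (f : C(UnitAddCircle, UnitAddCircle)) (α : ℤ) : Prop :=
  ∃ F : C(ℝ, ℝ), (∀ x : ℝ, f (x : UnitAddCircle) = (F x : UnitAddCircle)) ∧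
    ∀ x : ℝ, F (x + 1) = F x + α

/-- The cycle `C_m` and the triangle `K_3` are identified with the circle `ℝ/ℤ`, the vertex `i` of
`C_m` with the point `i/m`, the vertex `j` of `K_3` with the point `j/3`, and the edges with the
arcs between consecutive such points. Then `f` is the map of circles that is induced by the
homomorphism `φ`: it maps the arc from `i/m` to `(i+1)/m` affinely onto the arc
that corresponds to the edge of `K_3` from `φ i` to `φ (i+1)`. -/
def IsInducedCircleMap {m : ℕ} (φ : LoopGraph.Homs (LoopGraph.cycle m) (LoopGraph.complete 3))
    (f : C(UnitAddCircle, UnitAddCircle)) : Prop :=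
  ∀ (i : ℤ) (t : ℝ), 0 ≤ t → t ≤ 1 →
    f (((i + t) / m : ℝ) : UnitAddCircle) =
      ((((φ.1 (i : ZMod m)).val +
        t * (if φ.1 ((i : ZMod m) + 1) = φ.1 (i : ZMod m) + 1 then 1 else -1)) / 3 : ℝ) :
          UnitAddCircle)

/-- The homomorphism `φ` from the cycle `C_m` to `K_3` has winding number `α`. -/
def HasWindingNumber {m : ℕ} (φ : LoopGraph.Homs (LoopGraph.cycle m) (LoopGraph.complete 3))
    (α : ℤ) : Prop :=
  ∃ f : C(UnitAddCircle, UnitAddCircle), IsInducedCircleMap φ f ∧ IsWindingNumber f α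

end

/-! A homomorphism from a cycle to the triangle is a closed walk, and three times its winding number
is the sum of the signs of its steps. If two walks are vertices of one cell, their signs differ by a
coboundary of heights (`triStep_sub_triStep`), so the sums around the cycle agree. The winding
number is thus constant on closed cells, hence continuous for the weak topology. An odd number of
signs has an odd sum, so it never vanishes, and a reflection reverses every step, so it changes
sign. This already shows that no component is mapped to itself.

The components are found by writing a walk as a starting vertex and a list of steps. Exchanging two
consecutive steps moves a single vertex and stays in one cell, so only the start and the number of
positive steps matter; if both signs occur, exchanging the last step with the first moves the start
as well (`linked_of_windingSum_eq`). If all signs agree, the walk is rigid, and the three starts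
give three isolated points.

Nothing in the invariance argument needs the target to be the triangle: a 3-colouring of `G` yields
the same odd, sign-changing, locally constant function on `Hom(C_{2r+1}, G)`. This contradicts
connectedness. It also makes the Stiefel-Whitney class vanish: the sign of the function picks one
point of each orbit continuously, so the map of orbit spaces induced by a `ℤ₂`-map to the infinite
sphere factors through that sphere (`exists_lift_onOrbits`), whose first cohomology is zero because
it is contractible. -/

noncomputable section

/-! ### Cyclic sequences in `Fin 3` -/

/-- The sign of a step from `a` to `b` in the cyclically oriented triangle. -/
def triStep (a b : Fin 3) : ℤ := if b = a + 1 then 1 else -1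

/-- The height difference of two vertices of the triangle, measured along the path through the
third vertex. -/
def triDetour (a b : Fin 3) : ℤ := if b = a then 0 else -2 * triStep a b

/-- The sets `{a, a'}` and `{b, b'}` are disjoint in a set of three elements, so one of them is a
single vertex. If, say, `a = a'`, then the path from `b` to `b'` through `a` is the detour, and its
height is the difference of the two steps. -/
theorem triStep_sub_triStep : ∀ a b a' b' : Fin 3, a ≠ b → a ≠ b' → a' ≠ b → a' ≠ b' →
    triStep a' b' - triStep a b = triDetour b b' - triDetour a a' := by
  unfold triDetour triStep
  decide

theorem triStep_swap : ∀ a b : Fin 3, a ≠ b → triStep b a = -triStep a b := by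
  unfold triStep
  decide

theorem triStep_eq_or (a b : Fin 3) : triStep a b = 1 ∨ triStep a b = -1 := by
  unfold triStep
  split_ifs <;> simp

theorem val_add_triStep_emod (a b : Fin 3) (h : a ≠ b) :
    ((a.val : ℤ) + triStep a b - b.val) % 3 = 0 := by
  revert a b
  unfold triStep
  decide

/-! ### Sums of signs along closed walks -/

section WindingSum

variable {m : ℕ}

/-- A step changes the vertex by its sign modulo 3. With `j = m` this gives divisibility of the
winding sum by 3; for general `j` it shows that the piecewise affine lift passes through the right
vertices. -/
theorem val_add_sum_triStep (φ : ZMod m → Fin 3) (h1 : ∀ x, φ x ≠ φ (x + 1)) (j : ℕ) :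
    ∃ k : ℤ, ((φ 0).val : ℤ) + ∑ i ∈ Finset.range j, triStep (φ (i : ZMod m)) (φ (i + 1)) =
      (φ (j : ZMod m)).val + 3 * k := by
  induction j with
  | zero => exact ⟨0, by simp⟩
  | succ j ih =>
    obtain ⟨k, hk⟩ := ih
    have h := val_add_triStep_emod _ _ (h1 (j : ZMod m))
    refine ⟨k + (((φ (j : ZMod m)).val : ℤ) + triStep (φ (j : ZMod m)) (φ (j + 1)) -
      (φ ((j : ZMod m) + 1)).val) / 3, ?_⟩
    rw [Finset.sum_range_succ]
    push_cast
    omega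

/-- The walk in the triangle with start `a` and list of steps `l`. -/
def triWalk (m : ℕ) (a : Fin 3) (l : List (Fin 3)) : ZMod m → Fin 3 :=
  fun x => a + (l.take x.val).sum

theorem triWalk_zero (a : Fin 3) (l : List (Fin 3)) : triWalk m a l 0 = a := by
  simp [triWalk]

variable [NeZero m]

/-- The sum of the signs of the steps of a closed walk in the triangle. -/
def windingSum (φ : ZMod m → Fin 3) : ℤ := ∑ x, triStep (φ x) (φ (x + 1))

theorem sum_add_one_eq {M : Type*} [AddCommMonoid M] (f : ZMod m → M) :
    ∑ x, f (x + 1) = ∑ x, f x :=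
  Equiv.sum_comp (Equiv.addRight (1 : ZMod m)) f

/-- The differences of signs are differences of detour heights at consecutive vertices, and these
telescope to zero around the cycle. The hypotheses say that all choices between `φ` and `ψ` at each
vertex give walks. -/
theorem windingSum_eq_of_close (φ ψ : ZMod m → Fin 3) (h1 : ∀ x, φ x ≠ φ (x + 1))
    (h2 : ∀ x, ψ x ≠ ψ (x + 1)) (h3 : ∀ x, φ x ≠ ψ (x + 1)) (h4 : ∀ x, ψ x ≠ φ (x + 1)) :
    windingSum φ = windingSum ψ := by
  have h : ∑ x, (triStep (ψ x) (ψ (x + 1)) - triStep (φ x) (φ (x + 1))) =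
      ∑ x, (triDetour (φ (x + 1)) (ψ (x + 1)) - triDetour (φ x) (ψ x)) :=
    Finset.sum_congr rfl fun x _ => triStep_sub_triStep _ _ _ _ (h1 x) (h3 x) (h4 x) (h2 x)
  rw [Finset.sum_sub_distrib, Finset.sum_sub_distrib,
    sum_add_one_eq (fun x => triDetour (φ x) (ψ x))] at h
  unfold windingSum
  linarith

theorem windingSum_reflect (φ : ZMod m → Fin 3) (h1 : ∀ x, φ x ≠ φ (x + 1)) (c : ZMod m) :
    windingSum (fun x => φ (c - x)) = -windingSum φ := by
  unfold windingSum
  -- The reflection reverses edges: the one from `x` to `x + 1` comes from the edge starting at `c -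
  -- 1 - x`, hence the shift by one in the reindexing.
  rw [← Finset.sum_neg_distrib, ← Equiv.sum_comp (Equiv.subLeft (c - 1))]
  refine Finset.sum_congr rfl fun x _ => ?_
  simp only [Equiv.subLeft_apply]
  rw [show c - (c - 1 - x) = x + 1 by ring, show c - (c - 1 - x + 1) = x by ring]
  exact triStep_swap _ _ (h1 x)

theorem sum_zmod_eq_sum_range {M : Type*} [AddCommMonoid M] (f : ZMod m → M) :
    ∑ x, f x = ∑ i ∈ Finset.range m, f (i : ZMod m) := by
  refine Finset.sum_bij' (fun x _ => x.val) (fun i _ => (i : ZMod m)) ?_ ?_ ?_ ?_ ?_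
  · exact fun x _ => Finset.mem_range.2 x.val_lt
  · exact fun _ _ => Finset.mem_univ _
  · exact fun x _ => ZMod.natCast_zmod_val x
  · exact fun i hi => ZMod.val_cast_of_lt (Finset.mem_range.1 hi)
  · exact fun x _ => by rw [ZMod.natCast_zmod_val]

theorem three_dvd_windingSum (φ : ZMod m → Fin 3) (h1 : ∀ x, φ x ≠ φ (x + 1)) :
    3 ∣ windingSum φ := by
  obtain ⟨k, hk⟩ := val_add_sum_triStep φ h1 m
  unfold windingSum
  rw [sum_zmod_eq_sum_range (fun x => triStep (φ x) (φ (x + 1)))]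
  rw [ZMod.natCast_self] at hk
  exact ⟨k, by linarith⟩

theorem odd_windingSum (hm : Odd m) (φ : ZMod m → Fin 3) : Odd (windingSum φ) := by
  unfold windingSum
  have h : ∀ x, ∃ k : ℤ, triStep (φ x) (φ (x + 1)) = 2 * k + 1 := fun x => by
    rcases triStep_eq_or (φ x) (φ (x + 1)) with h | h
    · exact ⟨0, by rw [h]; rfl⟩
    · exact ⟨-1, by rw [h]; rfl⟩
  choose k hk using h
  obtain ⟨n, hn⟩ := hm
  refine ⟨∑ x, k x + n, ?_⟩
  simp only [hk, Finset.sum_add_distrib, ← Finset.mul_sum, Finset.sum_const, Finset.card_univ,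
    ZMod.card]
  rw [nsmul_eq_mul, show (m : ℤ) = 2 * n + 1 by exact_mod_cast hn]
  ring

theorem abs_windingSum_le (φ : ZMod m → Fin 3) : |windingSum φ| ≤ m := by
  refine (Finset.abs_sum_le_sum_abs _ _).trans ?_
  have h : ∀ x : ZMod m, |triStep (φ x) (φ (x + 1))| = 1 := fun x => by
    rcases triStep_eq_or (φ x) (φ (x + 1)) with h | h <;> simp [h]
  simp [h, ZMod.card]

theorem step_eq_one_of_windingSum_eq (φ : ZMod m → Fin 3) (h : windingSum φ = m) (x : ZMod m) :
    φ (x + 1) = φ x + 1 := by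
  by_contra hx
  have h1 : windingSum φ < ∑ _x : ZMod m, (1 : ℤ) := by
    refine Finset.sum_lt_sum (fun y _ => ?_) ⟨x, Finset.mem_univ x, ?_⟩
    · rcases triStep_eq_or (φ y) (φ (y + 1)) with h | h <;> simp [h]
    · simp [triStep, hx]
  simp [ZMod.card, h] at h1

theorem step_eq_two_of_windingSum_eq (φ : ZMod m → Fin 3) (h1 : ∀ x, φ x ≠ φ (x + 1))
    (h : windingSum φ = -m) (x : ZMod m) : φ (x + 1) = φ x + 2 := by
  have key : ∀ a b : Fin 3, a ≠ b → b ≠ a + 1 → b = a + 2 := by decide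
  refine key _ _ (h1 x) fun hx => ?_
  have h1 : ∑ _x : ZMod m, (-1 : ℤ) < windingSum φ := by
    refine Finset.sum_lt_sum (fun y _ => ?_) ⟨x, Finset.mem_univ x, ?_⟩
    · rcases triStep_eq_or (φ y) (φ (y + 1)) with h | h <;> simp [h]
    · simp [triStep, hx]
  simp [ZMod.card, h] at h1

/-! ### Walks given by their lists of steps -/

/-- The sign of a step given as a difference in `Fin 3`. -/
def stepSign (s : Fin 3) : ℤ := if s = 1 then 1 else -1

theorem triStep_add (a s : Fin 3) : triStep a (a + s) = stepSign s := by
  revert a s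
  unfold triStep stepSign
  decide

/-- For `i = m` the index wraps round to `0`; this is where the walk has to be closed. -/
theorem triWalk_natCast {l : List (Fin 3)} (hl : l.length = m) (h0 : l.sum = 0) (a : Fin 3)
    {i : ℕ} (hi : i ≤ m) : triWalk m a l (i : ZMod m) = a + (l.take i).sum := by
  rcases hi.lt_or_eq with h | h
  · simp [triWalk, ZMod.val_cast_of_lt h]
  · subst h
    rw [ZMod.natCast_self, triWalk_zero, ← hl, List.take_length, h0, add_zero]

theorem triWalk_succ {l : List (Fin 3)} (hl : l.length = m) (h0 : l.sum = 0) (a : Fin 3)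
    {i : ℕ} (hi : i < m) :
    triWalk m a l ((i : ZMod m) + 1) = triWalk m a l (i : ZMod m) + l[i]'(hl ▸ hi) := by
  have h1 := triWalk_natCast hl h0 a (Nat.succ_le_of_lt hi)
  rw [Nat.succ_eq_add_one, Nat.cast_add_one] at h1
  rw [h1, triWalk_natCast hl h0 a hi.le, add_assoc, List.sum_take_succ _ _ (hl ▸ hi)]

theorem triWalk_ne {l : List (Fin 3)} (hl : l.length = m) (h0 : l.sum = 0)
    (hne : ∀ s ∈ l, s ≠ 0) (a : Fin 3) (x : ZMod m) :
    triWalk m a l x ≠ triWalk m a l (x + 1) := by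
  have h := triWalk_succ hl h0 a x.val_lt
  rw [ZMod.natCast_zmod_val] at h
  rw [h]
  intro h2
  exact hne _ (List.getElem_mem _) (left_eq_add.1 h2)

theorem windingSum_triWalk {l : List (Fin 3)} (hl : l.length = m) (h0 : l.sum = 0) (a : Fin 3) :
    windingSum (triWalk m a l) = (l.map stepSign).sum := by
  unfold windingSum
  rw [sum_zmod_eq_sum_range (fun x => triStep (triWalk m a l x) (triWalk m a l (x + 1))),
    Finset.sum_range]
  rw [← List.sum_ofFn]
  congr 1
  refine List.ext_getElem (by simp [hl]) fun i h1 h2 => ?_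
  have hi : i < m := by simpa using h1
  simp only [List.getElem_ofFn, List.getElem_map]
  rw [triWalk_succ hl h0 a hi, triStep_add]

/-- The step `2` has sign `-1`, which is the same residue modulo 3. Hence a list of nonzero steps
closes up as soon as its sum of signs is divisible by 3. -/
theorem sum_stepSign_emod (l : List (Fin 3)) (hne : ∀ s ∈ l, s ≠ 0) :
    (l.map stepSign).sum % 3 = (l.sum.val : ℤ) := by
  induction l with
  | nil => simp
  | cons s l ih =>
    have h1 := ih fun t ht => hne t (List.mem_cons_of_mem _ ht)
    have h2 := hne s List.mem_cons_self
    have key : ∀ s t : Fin 3, s ≠ 0 → (stepSign s + t.val) % 3 = ((s + t).val : ℤ) := by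
      unfold stepSign
      decide
    rw [List.map_cons, List.sum_cons, List.sum_cons, ← key s _ h2, ← h1]
    omega

theorem sum_eq_zero_of_sum_stepSign {l : List (Fin 3)} (hne : ∀ s ∈ l, s ≠ 0) {α : ℤ}
    (h : (l.map stepSign).sum = 3 * α) : l.sum = 0 := by
  have h2 := sum_stepSign_emod l hne
  rw [h, Int.mul_emod_right] at h2
  exact Fin.ext (Int.natCast_eq_zero.1 h2.symm)

theorem sum_stepSign_eq (l : List (Fin 3)) :
    (l.map stepSign).sum = 2 * (l.count 1 : ℤ) - l.length := by
  induction l with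
  | nil => simp
  | cons s l ih =>
    rw [List.map_cons, List.sum_cons, ih, List.count_cons, List.length_cons, stepSign]
    by_cases h : s = 1
    · simp [h]; ring
    · simp [h]; ring

/-- Length and sum of signs determine how often each of the steps `1` and `2` occurs. -/
theorem perm_of_sum_stepSign_eq (l l' : List (Fin 3)) (hl : l.length = l'.length)
    (hne : ∀ s ∈ l, s ≠ 0) (hne' : ∀ s ∈ l', s ≠ 0)
    (h : (l.map stepSign).sum = (l'.map stepSign).sum) : l.Perm l' := by
  have hlen : ∀ l : List (Fin 3), l.length = l.count 0 + l.count 1 + l.count 2 := by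
    intro l
    induction l with
    | nil => simp
    | cons s l ih =>
      rw [List.length_cons, ih, List.count_cons, List.count_cons, List.count_cons]
      fin_cases s <;> simp <;> ring
  rw [sum_stepSign_eq, sum_stepSign_eq, hl] at h
  have h0 : l.count 0 = 0 := List.count_eq_zero.2 fun h => hne 0 h rfl
  have h0' : l'.count 0 = 0 := List.count_eq_zero.2 fun h => hne' 0 h rfl
  have h1 : l.count 1 = l'.count 1 := by omega
  rw [List.perm_iff_count]
  intro s
  have := hlen l
  have := hlen l'
  fin_cases s
  · exact h0.trans h0'.symm
  · exact h1
  · change l.count 2 = l'.count 2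
    omega

theorem exists_eq_triWalk (φ : ZMod m → Fin 3) :
    ∃ l : List (Fin 3), l.length = m ∧ l.sum = 0 ∧ φ = triWalk m (φ 0) l ∧
      ∀ s ∈ l, ∃ x, s = φ (x + 1) - φ x := by
  let l := List.ofFn fun i : Fin m => φ ((i.val : ZMod m) + 1) - φ (i.val : ZMod m)
  have hl : l.length = m := List.length_ofFn
  have key : ∀ i ≤ m, φ 0 + (l.take i).sum = φ (i : ZMod m) := by
    intro i
    induction i with
    | zero => simp
    | succ i ih =>
      intro hi
      rw [List.sum_take_succ _ _ (by omega), ← add_assoc, ih (by omega)]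
      simp [l]
  refine ⟨l, hl, ?_, ?_, ?_⟩
  · have h := key m le_rfl
    rw [ZMod.natCast_self, List.take_of_length_le hl.le] at h
    exact add_eq_left.1 h
  · funext x
    have h := key x.val x.val_lt.le
    rw [ZMod.natCast_zmod_val] at h
    exact h.symm
  · intro s hs
    obtain ⟨i, rfl⟩ := (List.mem_ofFn' _ _).1 hs
    exact ⟨_, rfl⟩

end WindingSum

/-! ### The topology of `Hom(T, G)` -/

theorem continuous_weakTopology_of_mem_cell {P κ ι Z : Type*} [TopologicalSpace Z]
    (coord : P → κ → ℝ) (cell : ι → Set P) (i : ι) (f : Z → P) (hf : ∀ z, f z ∈ cell i)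
    (hc : Continuous fun z => coord (f z)) : Continuous[_, weakTopology coord cell] f := by
  refine continuous_iSup_rng (i := i) ?_
  let _ : TopologicalSpace (cell i) :=
    TopologicalSpace.induced (fun p : cell i => coord p) inferInstance
  have h1 : Continuous (fun z => (⟨f z, hf z⟩ : cell i)) := continuous_induced_rng.2 hc
  let _ : TopologicalSpace P :=
    TopologicalSpace.coinduced (Subtype.val : cell i → P) inferInstance
  have h2 : Continuous (Subtype.val : cell i → P) := continuous_coinduced_rng
  exact h2.comp h1

theorem continuous_weakTopology_dom {P κ ι Y : Type*} [TopologicalSpace Y]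
    (coord : P → κ → ℝ) (cell : ι → Set P) (f : P → Y)
    (hf : ∀ i, Continuous[TopologicalSpace.induced (fun p : cell i => coord p) inferInstance, _]
      fun p : cell i => f p) : Continuous[weakTopology coord cell, _] f :=
  continuous_iSup_dom.2 fun i => continuous_coinduced_dom.2 (hf i)

namespace HomComplex

section General

variable {U V : Type*} [Finite U] {T : LoopGraph U} {G : LoopGraph V}

/-- In the weak topology continuity is tested on closed cells, where the function is constant. -/
theorem continuous_of_eq_on_closedCell {Y : Type*} [TopologicalSpace Y] (W : HomComplex T G → Y)
    (h : ∀ η, ∀ p ∈ closedCell η, ∀ q ∈ closedCell η, W p = W q) : Continuous W :=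
  continuous_weakTopology_dom _ _ _ fun η =>
    @continuous_of_const _ _ (_) _ _ fun p q => h η p p.2 q q.2

theorem continuous_coord : Continuous (coord : HomComplex T G → U × V → ℝ) :=
  continuous_weakTopology_dom _ _ _ fun _ => continuous_induced_dom

theorem coord_injective : Function.Injective (coord : HomComplex T G → U × V → ℝ) :=
  fun _ _ h => Subtype.ext (funext fun x => Finsupp.ext fun a => congrFun h (x, a))

theorem support_nonempty (p : HomComplex T G) (x : U) : (p.1 x).support.Nonempty := by
  rw [Finsupp.support_nonempty_iff]
  intro h
  have h1 := p.2.2.1 x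
  rw [h] at h1
  simp at h1

/-- The closed cell spanned by the supports of a point. -/
def supportCell (p : HomComplex T G) : CellIndex T G :=
  ⟨fun x => (p.1 x).support, support_nonempty p, p.2.2.2⟩

theorem mem_supportCell (p : HomComplex T G) : p ∈ closedCell (supportCell p) :=
  fun _ => subset_rfl

/-- A choice of a vertex in the support of every coordinate. -/
def select (p : HomComplex T G) (x : U) : V := (support_nonempty p x).choose

theorem select_mem (p : HomComplex T G) (x : U) : select p x ∈ (p.1 x).support :=
  (support_nonempty p x).choose_spec

theorem vertex_mem_closedCell (φ : LoopGraph.Homs T G) (η : CellIndex T G)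
    (h : ∀ x, φ.1 x ∈ η.1 x) : vertex φ ∈ closedCell η := fun x a ha => by
  rw [Finset.mem_singleton.1 (Finsupp.support_single_subset ha)]
  exact h x

/-- The points of the segment between two points of a closed cell. -/
def segment {η : CellIndex T G} {p q : HomComplex T G} (hp : p ∈ closedCell η)
    (hq : q ∈ closedCell η) (t : unitInterval) : closedCell η := by
  have hs : ∀ x, ((1 - t : ℝ) • p.1 x + (t : ℝ) • q.1 x).support ⊆ η.1 x := by
    intro x a ha
    by_contra h
    have h1 : p.1 x a = 0 := Finsupp.notMem_support_iff.1 fun h2 => h (hp x h2)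
    have h2 : q.1 x a = 0 := Finsupp.notMem_support_iff.1 fun h2 => h (hq x h2)
    simp [h1, h2] at ha
  refine ⟨⟨fun x => (1 - t : ℝ) • p.1 x + (t : ℝ) • q.1 x, fun x a => ?_, fun x => ?_,
    fun x y hxy a ha b hb => η.2.2 x y hxy a (hs x ha) b (hs y hb)⟩, hs⟩
  · have h1 := p.2.1 x a
    have h2 := q.2.1 x a
    have h3 := t.2.1
    have h4 := sub_nonneg.2 t.2.2
    simp only [Finsupp.add_apply, Finsupp.smul_apply, smul_eq_mul]
    positivity
  · rw [Finsupp.sum_add_index' (fun _ => rfl) (fun _ _ _ => rfl),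
      Finsupp.sum_smul_index' (fun _ => rfl), Finsupp.sum_smul_index' (fun _ => rfl)]
    have h1 := p.2.2.1 x
    have h2 := q.2.2.1 x
    simp only [smul_eq_mul]
    rw [← Finsupp.mul_sum, ← Finsupp.mul_sum, h1, h2]
    ring

theorem continuous_segment {η : CellIndex T G} {p q : HomComplex T G} (hp : p ∈ closedCell η)
    (hq : q ∈ closedCell η) : Continuous fun t => (segment hp hq t : HomComplex T G) := by
  refine continuous_weakTopology_of_mem_cell _ _ η _ (fun t => (segment hp hq t).2) ?_
  refine continuous_pi fun k => ?_
  change Continuous fun t : unitInterval => (1 - t : ℝ) * p.1 k.1 k.2 + (t : ℝ) * q.1 k.1 k.2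
  fun_prop

theorem connectedComponent_eq_of_mem_closedCell {η : CellIndex T G} {p q : HomComplex T G}
    (hp : p ∈ closedCell η) (hq : q ∈ closedCell η) :
    connectedComponent p = connectedComponent q := by
  have h0 : (segment hp hq 0 : HomComplex T G) = p :=
    Subtype.ext (funext fun x => by simp [segment])
  have h1 : (segment hp hq 1 : HomComplex T G) = q :=
    Subtype.ext (funext fun x => by simp [segment])
  refine connectedComponent_eq ?_
  exact (isPreconnected_range (continuous_segment hp hq)).subset_connectedComponent ⟨0, h0⟩ ⟨1, h1⟩

end General

/-! ### The winding number as a locally constant function -/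

section Winding

variable {V : Type*} {G : LoopGraph V} {m : ℕ} [NeZero m]

/-- The winding number of a point of `Hom(C_m, G)` with respect to a map from `G` to the triangle.
-/
def windingNumber (f : V → Fin 3) (p : HomComplex (LoopGraph.cycle m) G) : ℤ :=
  windingSum (fun x => f (select p x)) / 3

/-- Any two choices of vertices in one cell satisfy the hypotheses of `windingSum_eq_of_close` after
colouring. So the arbitrary choice in `select` does not matter, nor does the position of `p` in the
cell. -/
theorem windingNumber_eq {f : V → Fin 3} (hf : ∀ a b, G.Adj a b → f a ≠ f b)
    {p : HomComplex (LoopGraph.cycle m) G} {η : CellIndex (LoopGraph.cycle m) G}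
    (hp : p ∈ closedCell η) {φ : ZMod m → V} (hφ : ∀ x, φ x ∈ η.1 x) :
    windingNumber f p = windingSum (fun x => f (φ x)) / 3 := by
  unfold windingNumber
  have h : ∀ x, select p x ∈ η.1 x := fun x => hp x (select_mem p x)
  have key : ∀ ψ χ : ZMod m → V, (∀ x, ψ x ∈ η.1 x) → (∀ x, χ x ∈ η.1 x) →
      ∀ x, f (ψ x) ≠ f (χ (x + 1)) := fun ψ χ hψ hχ x =>
    hf _ _ (η.2.2 x (x + 1) (Or.inl rfl) _ (hψ x) _ (hχ (x + 1)))
  rw [windingSum_eq_of_close _ _ (key _ _ h h) (key _ _ hφ hφ) (key _ _ h hφ) (key _ _ hφ h)]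

theorem map_select_ne {f : V → Fin 3} (hf : ∀ a b, G.Adj a b → f a ≠ f b)
    (p : HomComplex (LoopGraph.cycle m) G) (x : ZMod m) :
    f (select p x) ≠ f (select p (x + 1)) :=
  hf _ _ (p.2.2.2 x (x + 1) (Or.inl rfl) _ (select_mem p x) _ (select_mem p (x + 1)))

theorem three_mul_windingNumber {f : V → Fin 3} (hf : ∀ a b, G.Adj a b → f a ≠ f b)
    (p : HomComplex (LoopGraph.cycle m) G) :
    3 * windingNumber f p = windingSum fun x => f (select p x) :=
  Int.mul_ediv_cancel' (three_dvd_windingSum _ (map_select_ne hf p))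

theorem continuous_windingNumber {f : V → Fin 3} (hf : ∀ a b, G.Adj a b → f a ≠ f b) :
    Continuous (windingNumber f : HomComplex (LoopGraph.cycle m) G → ℤ) :=
  continuous_of_eq_on_closedCell _ fun η p hp q hq => by
    have h : ∀ x, select p x ∈ η.1 x := fun x => hp x (select_mem p x)
    rw [windingNumber_eq hf hp h, windingNumber_eq hf hq h]

theorem odd_windingNumber (hm : Odd m) {f : V → Fin 3} (hf : ∀ a b, G.Adj a b → f a ≠ f b)
    (p : HomComplex (LoopGraph.cycle m) G) : Odd (windingNumber f p) := by
  have h := odd_windingSum hm fun x => f (select p x)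
  rw [← three_mul_windingNumber hf] at h
  exact (Int.odd_mul.1 h).2

theorem windingNumber_reflection {r : ℕ} {c : ZMod (2 * r + 1)} (hG : G.Loopless)
    {f : V → Fin 3} (hf : ∀ a b, G.Adj a b → f a ≠ f b)
    (p : HomComplex (LoopGraph.cycle (2 * r + 1)) G) :
    windingNumber f ((reflection r c hG).toFun p) = -windingNumber f p := by
  have h := windingNumber_eq hf (mem_supportCell ((reflection r c hG).toFun p))
    (φ := fun x => select p (c - x)) fun x => select_mem p (c - x)
  have h1 := windingSum_reflect (fun x => f (select p x)) (map_select_ne hf p) c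
  rw [h, h1, ← three_mul_windingNumber hf]
  omega

end Winding

end HomComplex

namespace HomComplex

/-! ### The connected components of `Hom(C_m, K_3)` -/

section Components

variable {m : ℕ} [NeZero m]

/-- The homomorphism from a cycle to the triangle given by a closed walk. -/
def triHom (φ : ZMod m → Fin 3) (h : ∀ x, φ x ≠ φ (x + 1)) :
    LoopGraph.Homs (LoopGraph.cycle m) (LoopGraph.complete 3) :=
  ⟨φ, by
    rintro x y (rfl | rfl)
    · exact h x
    · exact (h y).symm⟩

/-- Two closed walks in the triangle are linked if they are vertices of the same connected
component. -/
def Linked (φ ψ : ZMod m → Fin 3) : Prop :=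
  ∃ hφ hψ, connectedComponent (vertex (triHom φ hφ)) = connectedComponent (vertex (triHom ψ hψ))

theorem Linked.refl {φ : ZMod m → Fin 3} (h : ∀ x, φ x ≠ φ (x + 1)) : Linked φ φ := ⟨h, h, rfl⟩

theorem Linked.symm {φ ψ : ZMod m → Fin 3} : Linked φ ψ → Linked ψ φ :=
  fun ⟨h1, h2, h⟩ => ⟨h2, h1, h.symm⟩

theorem Linked.trans {φ ψ χ : ZMod m → Fin 3} : Linked φ ψ → Linked ψ χ → Linked φ χ :=
  fun ⟨h1, _, h⟩ ⟨_, h2, h'⟩ => ⟨h1, h2, h.trans h'⟩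

theorem linked_of_close {φ ψ : ZMod m → Fin 3} (h1 : ∀ x, φ x ≠ φ (x + 1))
    (h2 : ∀ x, ψ x ≠ ψ (x + 1)) (h3 : ∀ x, φ x ≠ ψ (x + 1)) (h4 : ∀ x, ψ x ≠ φ (x + 1)) :
    Linked φ ψ := by
  refine ⟨h1, h2, connectedComponent_eq_of_mem_closedCell
    (η := ⟨fun x => {φ x, ψ x}, fun x => ⟨φ x, by simp⟩, ?_⟩)
    (vertex_mem_closedCell _ _ fun x => ?_) (vertex_mem_closedCell _ _ fun x => ?_)⟩
  · have key : ∀ x, ∀ a ∈ ({φ x, ψ x} : Finset (Fin 3)),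
        ∀ b ∈ ({φ (x + 1), ψ (x + 1)} : Finset (Fin 3)), a ≠ b := by
      intro x a ha b hb
      simp only [Finset.mem_insert, Finset.mem_singleton] at ha hb
      rcases ha with rfl | rfl <;> rcases hb with rfl | rfl
      exacts [h1 x, h3 x, h4 x, h2 x]
    rintro x y (rfl | rfl) a ha b hb
    · exact key x a ha b hb
    · exact (key y b hb a ha).symm
  · simp [triHom]
  · simp [triHom]

/-- Since `1 < m`, the vertex `k` is not its own neighbour, so both of its values are compatible
with the common values at the neighbours, and both walks lie in one cell. -/
theorem linked_of_eq_off (hm : 1 < m) {φ ψ : ZMod m → Fin 3} (h1 : ∀ x, φ x ≠ φ (x + 1))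
    (h2 : ∀ x, ψ x ≠ ψ (x + 1)) (k : ZMod m) (h : ∀ x, x ≠ k → φ x = ψ x) : Linked φ ψ := by
  have : Fact (1 < m) := ⟨hm⟩
  have hk : ∀ x : ZMod m, x + 1 = k → x ≠ k := by
    rintro x rfl hx
    exact one_ne_zero (left_eq_add.1 hx)
  refine linked_of_close h1 h2 (fun x => ?_) fun x => ?_
  · by_cases hx : x + 1 = k
    · rw [h x (hk x hx)]
      exact h2 x
    · rw [← h _ hx]
      exact h1 x
  · by_cases hx : x + 1 = k
    · rw [← h x (hk x hx)]
      exact h1 x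
    · rw [h _ hx]
      exact h2 x

/-- Exchanging two consecutive steps moves only the vertex between them. The prefix `u` lets the
induction over permutations reach steps that are not at the beginning. -/
theorem linked_triWalk_of_perm (hm : 1 < m) (a : Fin 3) {l l' : List (Fin 3)} (h : l.Perm l') :
    ∀ u : List (Fin 3), (u ++ l).length = m → (u ++ l).sum = 0 → (∀ s ∈ u ++ l, s ≠ 0) →
      Linked (triWalk m a (u ++ l)) (triWalk m a (u ++ l')) := by
  induction h with
  | nil => exact fun u h1 h2 h3 => Linked.refl (triWalk_ne h1 h2 h3 a)
  | cons x _ ih =>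
    intro u h1 h2 h3
    have h := ih (u ++ [x]) (by simpa using h1) (by simpa [add_assoc] using h2)
      (by simpa using h3)
    simpa using h
  | swap x y l =>
    intro u h1 h2 h3
    have hp : (u ++ y :: x :: l).Perm (u ++ x :: y :: l) := (List.Perm.swap x y l).append_left u
    refine linked_of_eq_off hm (triWalk_ne h1 h2 h3 a)
      (triWalk_ne (hp.length_eq ▸ h1) (hp.sum_eq ▸ h2) (fun s hs => h3 s (hp.mem_iff.2 hs)) a)
      ((u.length + 1 : ℕ) : ZMod m) fun z hz => ?_
    have hz1 : z.val ≠ u.length + 1 := fun h => hz (by rw [← h, ZMod.natCast_zmod_val])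
    unfold triWalk
    rw [List.take_append, List.take_append]
    congr 1
    rw [List.sum_append, List.sum_append]
    congr 1
    -- Up to `j = 0` neither exchanged step has been taken, from `j = 2` on both have; `j = 1` is
    -- the vertex that moves.
    generalize hj : z.val - u.length = j
    match j with
    | 0 => simp
    | 1 => omega
    | j + 2 =>
      simp only [List.take_succ_cons, List.sum_cons]
      exact add_left_comm _ _ _
  | trans h1 _ ih1 ih2 =>
    intro u h2 h3 h4
    have hp := h1.append_left u
    exact (ih1 u h2 h3 h4).trans (ih2 u (hp.length_eq ▸ h2) (hp.sum_eq ▸ h3)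
      fun s hs => h4 s (hp.mem_iff.2 hs))

/-- Reorder the steps to begin with `1` and end with `2`, and exchange these two across the base
point: this moves only the vertex `0`, from `a` to `a + 2`, because `a + 1 = (a + 2) + 2`. -/
theorem linked_triWalk_add_two (hm : 1 < m) (a : Fin 3) {l : List (Fin 3)} (hl : l.length = m)
    (h0 : l.sum = 0) (hne : ∀ s ∈ l, s ≠ 0) (h1 : 1 ∈ l) (h2 : 2 ∈ l) :
    Linked (triWalk m a l) (triWalk m (a + 2) l) := by
  obtain ⟨u, hu⟩ : ∃ u : List (Fin 3), l.Perm (1 :: (u ++ [2])) := by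
    refine ⟨(l.erase 1).erase 2, (List.perm_cons_erase h1).trans (List.Perm.cons _ ?_)⟩
    have h3 : (2 : Fin 3) ∈ l.erase 1 := (List.mem_erase_of_ne (by decide)).2 h2
    exact (List.perm_cons_erase h3).trans (List.perm_append_singleton _ _).symm
  have hu' : l.Perm (2 :: (u ++ [1])) := by
    refine hu.trans (((List.perm_append_singleton _ _).cons _).trans ?_)
    exact (List.Perm.swap _ _ _).trans ((List.perm_append_singleton _ _).symm.cons _)
  have e1 := linked_triWalk_of_perm hm a hu [] hl h0 hne
  have e2 := linked_triWalk_of_perm hm (a + 2) hu' [] hl h0 hne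
  refine e1.trans (Linked.trans ?_ e2.symm)
  obtain ⟨_, g1, _⟩ := e1
  obtain ⟨_, g2, _⟩ := e2
  refine linked_of_eq_off hm g1 g2 0 fun z hz => ?_
  have hz1 : z.val ≠ 0 := fun h => hz ((ZMod.val_eq_zero z).1 h)
  have hlen : u.length + 2 = m := by rw [← hl, hu.length_eq]; simp
  obtain ⟨j, hj⟩ := Nat.exists_eq_succ_of_ne_zero hz1
  have hj1 : j ≤ u.length := by have := z.val_lt; omega
  simp only [triWalk, List.nil_append, hj, Nat.succ_eq_add_one, List.take_succ_cons,
    List.take_append_of_le_length hj1, List.sum_cons, ← add_assoc]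
  congr 1
  have key : ∀ a : Fin 3, a + 1 = a + 2 + 2 := by decide
  exact key a

theorem linked_of_windingSum_eq (hm : 1 < m) {φ ψ : ZMod m → Fin 3} (h1 : ∀ x, φ x ≠ φ (x + 1))
    (h2 : ∀ x, ψ x ≠ ψ (x + 1)) (h : windingSum φ = windingSum ψ) (hlt : |windingSum φ| < m) :
    Linked φ ψ := by
  obtain ⟨l, hl, h0, e, hs⟩ := exists_eq_triWalk φ
  obtain ⟨l', hl', h0', e', hs'⟩ := exists_eq_triWalk ψ
  have hne : ∀ s ∈ l, s ≠ 0 := fun s hsl => by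
    obtain ⟨x, rfl⟩ := hs s hsl
    exact sub_ne_zero.2 (h1 x).symm
  have hne' : ∀ s ∈ l', s ≠ 0 := fun s hsl => by
    obtain ⟨x, rfl⟩ := hs' s hsl
    exact sub_ne_zero.2 (h2 x).symm
  generalize φ 0 = a at e
  generalize ψ 0 = b at e'
  subst e e'
  rw [windingSum_triWalk hl h0] at h hlt
  rw [windingSum_triWalk hl' h0'] at h
  have hp := perm_of_sum_stepSign_eq l l' (hl.trans hl'.symm) hne hne' h
  refine (linked_triWalk_of_perm hm a hp [] hl h0 hne).trans ?_
  rw [h] at hlt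
  -- The strict bound excludes constant lists, so both kinds of steps occur and the start can be
  -- moved.
  have hconst : ∀ s : Fin 3, l' ≠ List.replicate m s := by
    rintro s rfl
    rw [List.map_replicate, List.sum_replicate, nsmul_eq_mul] at hlt
    unfold stepSign at hlt
    split_ifs at hlt <;> simp at hlt
  have hc : ∀ s : Fin 3, s ≠ 0 → ∃ t ∈ l', t ≠ s := fun s _ => by
    by_contra! hc
    exact hconst s (List.eq_replicate_iff.2 ⟨hl', hc⟩)
  have m1 : (1 : Fin 3) ∈ l' := by
    obtain ⟨t, ht, ht2⟩ := hc 2 (by decide)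
    have h3 := hne' t ht
    have key : ∀ t : Fin 3, t ≠ 2 → t ≠ 0 → t = 1 := by decide
    exact key t ht2 h3 ▸ ht
  have m2 : (2 : Fin 3) ∈ l' := by
    obtain ⟨t, ht, ht2⟩ := hc 1 (by decide)
    have h3 := hne' t ht
    have key : ∀ t : Fin 3, t ≠ 1 → t ≠ 0 → t = 2 := by decide
    exact key t ht2 h3 ▸ ht
  have s1 := fun a => linked_triWalk_add_two hm a hl' h0' hne' m1 m2
  have key : ∀ a b : Fin 3, b = a ∨ b = a + 2 ∨ b = a + 2 + 2 := by decide
  rw [List.nil_append]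
  rcases key a b with rfl | rfl | rfl
  · exact Linked.refl h2
  · exact s1 a
  · exact (s1 a).trans (s1 _)

theorem id_coloring (n : ℕ) : ∀ a b, (LoopGraph.complete n).Adj a b → id a ≠ id b :=
  fun _ _ h => h

theorem connectedComponent_eq_vertex_select
    (p : HomComplex (LoopGraph.cycle m) (LoopGraph.complete 3)) :
    connectedComponent p =
      connectedComponent (vertex (triHom (select p) (map_select_ne (id_coloring 3) p))) :=
  connectedComponent_eq_of_mem_closedCell (mem_supportCell p)
    (vertex_mem_closedCell _ _ fun x => select_mem p x)

theorem windingNumber_vertex (φ : LoopGraph.Homs (LoopGraph.cycle m) (LoopGraph.complete 3)) :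
    windingNumber id (vertex φ) = windingSum φ.1 / 3 :=
  windingNumber_eq (id_coloring 3) (η := ⟨fun x => {φ.1 x}, fun x => ⟨φ.1 x, by simp⟩,
    fun x y hxy a ha b hb => by
      rw [Finset.mem_singleton.1 ha, Finset.mem_singleton.1 hb]
      exact φ.2 x y hxy⟩)
    (vertex_mem_closedCell _ _ fun x => by simp) fun x => by simp

theorem windingNumber_eq_of_mem_connectedComponent
    {p q : HomComplex (LoopGraph.cycle m) (LoopGraph.complete 3)}
    (h : q ∈ connectedComponent p) : windingNumber id q = windingNumber id p :=
  isPreconnected_connectedComponent.constant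
    (continuous_windingNumber (id_coloring 3)).continuousOn h mem_connectedComponent

theorem connectedComponent_eq_windingNumber_preimage (hm : 1 < m)
    (p : HomComplex (LoopGraph.cycle m) (LoopGraph.complete 3))
    (h : 3 * |windingNumber id p| < m) :
    connectedComponent p = windingNumber id ⁻¹' {windingNumber id p} := by
  refine Set.Subset.antisymm (fun q hq => windingNumber_eq_of_mem_connectedComponent hq)
    fun q hq => ?_
  have e1 := three_mul_windingNumber (id_coloring 3) p
  have e2 := three_mul_windingNumber (id_coloring 3) q
  rw [Set.mem_singleton_iff.1 hq] at e2
  obtain ⟨_, _, hl⟩ := linked_of_windingSum_eq hm (map_select_ne (id_coloring 3) p)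
    (map_select_ne (id_coloring 3) q) (e1.symm.trans e2) (by
      rw [← e1, abs_mul]
      exact h)
  rw [connectedComponent_eq_vertex_select p]
  have e := (connectedComponent_eq_vertex_select q).trans hl.symm
  exact e ▸ mem_connectedComponent

theorem windingNumber_triWalk {l : List (Fin 3)} (hl : l.length = m) (h0 : l.sum = 0)
    (hne : ∀ s ∈ l, s ≠ 0) (a : Fin 3) :
    windingNumber id (vertex (triHom (triWalk m a l) (triWalk_ne hl h0 hne a))) =
      (l.map stepSign).sum / 3 := by
  rw [windingNumber_vertex]
  exact congrArg (· / 3) (windingSum_triWalk hl h0 a)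

theorem range_windingNumber (hm : Odd m) :
    Set.range (windingNumber id :
      HomComplex (LoopGraph.cycle m) (LoopGraph.complete 3) → ℤ) =
      {α : ℤ | Odd α ∧ 3 * |α| ≤ m} := by
  ext α
  constructor
  · rintro ⟨p, rfl⟩
    refine ⟨odd_windingNumber hm (id_coloring 3) p, ?_⟩
    have h := abs_windingSum_le (fun x => id (select p x))
    rw [← three_mul_windingNumber (id_coloring 3), abs_mul] at h
    exact h
  · rintro ⟨⟨k, hk⟩, h⟩
    obtain ⟨n, hn⟩ := hm
    have h1 := abs_le.1 (show |α| ≤ m / 3 by omega)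
    -- With `i` positive and `j` negative steps, `i + j = m = 2 * n + 1` and `i - j = 3 * α = 6 * k
    -- + 3`.
    obtain ⟨i, hi⟩ := Int.eq_ofNat_of_zero_le (show 0 ≤ (n : ℤ) + 3 * k + 2 by omega)
    obtain ⟨j, hj⟩ := Int.eq_ofNat_of_zero_le (show 0 ≤ (n : ℤ) - 3 * k - 1 by omega)
    let l : List (Fin 3) := List.replicate i 1 ++ List.replicate j 2
    have hl : l.length = m := by
      simp only [l, List.length_append, List.length_replicate]
      omega
    have hne : ∀ s ∈ l, s ≠ 0 := by
      intro s hs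
      rcases List.mem_append.1 hs with h | h
      · rw [List.eq_of_mem_replicate h]
        decide
      · rw [List.eq_of_mem_replicate h]
        decide
    have hsum : (l.map stepSign).sum = 3 * α := by
      simp only [l, List.map_append, List.map_replicate, List.sum_append, List.sum_replicate]
      simp only [stepSign, nsmul_eq_mul]
      simp
      omega
    have h0 : l.sum = 0 := sum_eq_zero_of_sum_stepSign hne hsum
    refine ⟨_, (windingNumber_triWalk hl h0 hne 0).trans ?_⟩
    rw [hsum]
    omega

theorem exists_step_of_three_mul_abs_windingNumber {α : ℤ} (h : 3 * |α| = m) :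
    ∃ s : Fin 3, s ≠ 0 ∧ m * stepSign s = 3 * α ∧
      ∀ φ : ZMod m → Fin 3, (∀ x, φ x ≠ φ (x + 1)) → windingSum φ = 3 * α →
        ∀ x, φ (x + 1) = φ x + s := by
  rcases abs_cases α with ⟨h1, _⟩ | ⟨h1, _⟩
  · refine ⟨1, by decide, ?_, fun φ _ h2 => step_eq_one_of_windingSum_eq φ (by omega)⟩
    simp only [stepSign, if_true]
    omega
  · refine ⟨2, by decide, ?_, fun φ h3 h2 => step_eq_two_of_windingSum_eq φ h3 (by omega)⟩
    simp only [stepSign, show (2 : Fin 3) ≠ 1 by decide, if_false]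
    omega

theorem eq_vertex_of_support_subset {U V : Type*} [Finite U] {T : LoopGraph U} {G : LoopGraph V}
    (p : HomComplex T G) (φ : LoopGraph.Homs T G) (h : ∀ x, (p.1 x).support ⊆ {φ.1 x}) :
    p = vertex φ := by
  refine Subtype.ext (funext fun x => ?_)
  obtain ⟨t, ht⟩ := Finsupp.support_subset_singleton'.1 (h x)
  have h1 := p.2.2.1 x
  rw [ht, Finsupp.sum_single_index rfl] at h1
  change p.1 x = Finsupp.single (φ.1 x) 1
  rw [ht, h1]

/-- In the extreme case all steps are equal, so a walk is determined by its start, and no cell of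
positive dimension can occur. -/
theorem exists_injective_range_eq_windingNumber_preimage (hm : 1 < m) {α : ℤ}
    (h : 3 * |α| = m) :
    ∃ F : Fin 3 → HomComplex (LoopGraph.cycle m) (LoopGraph.complete 3),
      Function.Injective F ∧ Set.range F = windingNumber id ⁻¹' {α} := by
  have : Fact (1 < m) := ⟨hm⟩
  obtain ⟨s, hs0, hs, hstep⟩ := exists_step_of_three_mul_abs_windingNumber h
  have hl : (List.replicate m s).length = m := List.length_replicate
  have hne : ∀ t ∈ List.replicate m s, t ≠ 0 := fun t ht => by
    rwa [List.eq_of_mem_replicate ht]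
  have hsum : ((List.replicate m s).map stepSign).sum = 3 * α := by
    rw [List.map_replicate, List.sum_replicate, nsmul_eq_mul, hs]
  have h0 : (List.replicate m s).sum = 0 := sum_eq_zero_of_sum_stepSign hne hsum
  refine ⟨fun a => vertex (triHom (triWalk m a _) (triWalk_ne hl h0 hne a)), ?_, ?_⟩
  · intro a b hab
    have h1 := congrFun (congrArg Subtype.val hab) 0
    have h2 := (Finsupp.single_left_inj one_ne_zero).1 h1
    simpa [triHom, triWalk_zero] using h2
  · ext p
    constructor
    · rintro ⟨a, rfl⟩
      rw [Set.mem_preimage, windingNumber_triWalk hl h0 hne a, hsum, Set.mem_singleton_iff]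
      omega
    · intro hp
      have hp' : windingNumber id p = α := hp
      have key : ∀ φ : ZMod m → Fin 3, (∀ x, φ x ∈ (p.1 x).support) →
          ∀ x, φ (x + 1) = φ x + s := by
        intro φ hφ
        have h1 : ∀ x, φ x ≠ φ (x + 1) := fun x =>
          p.2.2.2 x (x + 1) (Or.inl rfl) _ (hφ x) _ (hφ (x + 1))
        refine hstep φ h1 ?_
        have h2 := windingNumber_eq (id_coloring 3) (mem_supportCell p) hφ
        have h3 := three_dvd_windingSum φ h1
        simp only [id] at h2
        rw [← hp', h2, Int.mul_ediv_cancel' h3]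
      obtain ⟨l, hl', _, e, hsl⟩ := exists_eq_triWalk (select p)
      have hl'' : l = List.replicate m s := by
        refine List.eq_replicate_iff.2 ⟨hl', fun t ht => ?_⟩
        obtain ⟨x, rfl⟩ := hsl t ht
        rw [key _ (select_mem p), add_sub_cancel_left]
      subst hl''
      refine ⟨select p 0, (eq_vertex_of_support_subset p _ fun x b hb => ?_).symm⟩
      -- Replacing the chosen vertex at `x` alone by `b` gives another walk with constant step `s`
      -- and the same value at `x + 1`; hence `b` was the chosen vertex.
      have h1 := key (Function.update (select p) x b) (fun y => by
        by_cases hy : y = x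
        · subst hy
          simpa using hb
        · simpa [hy] using select_mem p y) x
      have hx : x + 1 ≠ x := fun h => one_ne_zero (add_eq_left.1 h)
      rw [Function.update_of_ne hx, Function.update_self, key _ (select_mem p)] at h1
      rw [Finset.mem_singleton, ← add_right_cancel h1]
      exact congrFun e x

theorem ncard_windingNumber_preimage (hm : 1 < m) {α : ℤ} (h : 3 * |α| = m) :
    (windingNumber id ⁻¹' {α} :
      Set (HomComplex (LoopGraph.cycle m) (LoopGraph.complete 3))).ncard = 3 := by
  obtain ⟨F, hF, e⟩ := exists_injective_range_eq_windingNumber_preimage hm h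
  rw [← e, ← Set.image_univ, Set.ncard_image_of_injective _ hF, Set.ncard_univ, Nat.card_fin]

/-- The component lies in a finite fibre, so each coordinate has a finite connected image in `ℝ`,
and coordinates separate points. -/
theorem connectedComponent_eq_singleton (hm : 1 < m)
    (p : HomComplex (LoopGraph.cycle m) (LoopGraph.complete 3))
    (h : 3 * |windingNumber id p| = m) : connectedComponent p = {p} := by
  have hfin : (connectedComponent p).Finite := by
    refine Set.Finite.subset (s := windingNumber id ⁻¹' {windingNumber id p}) ?_
      fun q hq => windingNumber_eq_of_mem_connectedComponent hq
    exact Set.finite_of_ncard_ne_zero (by rw [ncard_windingNumber_preimage hm h]; decide)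
  refine Set.Subsingleton.eq_singleton_of_mem (fun a ha b hb => coord_injective ?_)
    mem_connectedComponent
  funext k
  have hc : Continuous fun q : HomComplex (LoopGraph.cycle m) (LoopGraph.complete 3) =>
    coord q k := (continuous_apply k).comp continuous_coord
  exact (hfin.image _).countable.isTotallyDisconnected _ subset_rfl
    (isPreconnected_connectedComponent.image _ hc.continuousOn) ⟨a, ha, rfl⟩ ⟨b, hb, rfl⟩

end Components

end HomComplex

/-! ### Winding numbers of homomorphisms -/

theorem cast_triStep (a b : Fin 3) : ((triStep a b : ℤ) : ℝ) = if b = a + 1 then 1 else -1 := by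
  unfold triStep
  split_ifs <;> simp

theorem sub_eq_of_continuousOn_of_coe_eq_zero {g : ℝ → ℝ} (hg : ContinuousOn g (Set.Icc 0 1))
    (h : ∀ t ∈ Set.Icc (0 : ℝ) 1, (g t : UnitAddCircle) = 0) : g 1 = g 0 := by
  have h1 : (g '' Set.Icc 0 1).Countable := by
    refine (Set.countable_range (fun n : ℤ => (n : ℝ))).mono ?_
    rintro _ ⟨t, ht, rfl⟩
    obtain ⟨n, hn⟩ := AddCircle.coe_eq_zero_iff 1 |>.1 (h t ht)
    exact ⟨n, by simpa using hn⟩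
  exact h1.isTotallyDisconnected _ subset_rfl (isPreconnected_Icc.image _ hg)
    ⟨1, by simp, rfl⟩ ⟨0, by simp, rfl⟩

section CircleMaps

variable {m : ℕ}

/-- The piecewise affine map on the unit interval with value `a / 3` at `0` and slope
`m * d i / 3` between `i / m` and `(i + 1) / m`. -/
def piecewiseAffine (m : ℕ) (a : ℝ) (d : ℕ → ℝ) (y : ℝ) : ℝ :=
  (a + ∑ i ∈ Finset.range m, d i * max 0 (min (m * y - i) 1)) / 3

theorem continuous_piecewiseAffine (a : ℝ) (d : ℕ → ℝ) : Continuous (piecewiseAffine m a d) := by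
  unfold piecewiseAffine
  fun_prop

variable [NeZero m]

/-- On each edge the lift `F` differs from the affine lift by a continuous integer-valued function,
so it grows by the sign of the step divided by 3. -/
theorem three_mul_eq_windingSum_of_isWindingNumber
    {φ : LoopGraph.Homs (LoopGraph.cycle m) (LoopGraph.complete 3)}
    {f : C(UnitAddCircle, UnitAddCircle)} (hf : IsInducedCircleMap φ f) {α : ℤ}
    (hα : IsWindingNumber f α) : 3 * α = windingSum φ.1 := by
  obtain ⟨F, hF, hF1⟩ := hα
  have hm : (m : ℝ) ≠ 0 := Nat.cast_ne_zero.2 (NeZero.ne m)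
  have key : ∀ i : ℕ, F ((i + 1) / m) - F (i / m) =
      (triStep (φ.1 (i : ZMod m)) (φ.1 (i + 1)) : ℤ) / 3 := by
    intro i
    have h := sub_eq_of_continuousOn_of_coe_eq_zero
      (g := fun t => F ((i + t) / m) - ((φ.1 (i : ZMod m)).val +
        t * (triStep (φ.1 (i : ZMod m)) (φ.1 (i + 1)) : ℤ)) / 3) (by fun_prop) (by
          intro t ht
          have h1 := hf i t ht.1 ht.2
          rw [Int.cast_natCast, Int.cast_natCast, hF, ← cast_triStep] at h1
          rw [AddCircle.coe_sub, h1, sub_self])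
    simp only [one_mul, zero_mul, add_zero] at h
    linarith
  have hsum : ∀ j : ℕ, F (j / m) - F 0 =
      ((∑ i ∈ Finset.range j, triStep (φ.1 (i : ZMod m)) (φ.1 (i + 1)) : ℤ) : ℝ) / 3 := by
    intro j
    induction j with
    | zero => simp
    | succ j ih =>
      rw [Finset.sum_range_succ]
      have h := key j
      push_cast at ih ⊢
      linarith
  have h1 := hsum m
  rw [← sum_zmod_eq_sum_range (fun x => triStep (φ.1 x) (φ.1 (x + 1))), div_self hm] at h1
  have h2 := hF1 0
  rw [zero_add] at h2
  have h3 : (3 * α : ℝ) = (windingSum φ.1 : ℤ) := by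
    unfold windingSum
    linarith
  exact_mod_cast h3

theorem piecewiseAffine_apply (a : ℝ) (d : ℕ → ℝ) {j : ℕ} (hj : j < m) {t : ℝ} (h0 : 0 ≤ t)
    (h1 : t ≤ 1) : piecewiseAffine m a d ((j + t) / m) =
      (a + ∑ i ∈ Finset.range j, d i + t * d j) / 3 := by
  have hm : (m : ℝ) ≠ 0 := Nat.cast_ne_zero.2 (NeZero.ne m)
  unfold piecewiseAffine
  rw [mul_div_cancel₀ _ hm, ← Finset.sum_subset (Finset.range_subset_range.2 hj),
    Finset.sum_range_succ, add_assoc]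
  · congr 3
    · refine Finset.sum_congr rfl fun i hi => ?_
      have h2 : (i : ℝ) + 1 ≤ j := by exact_mod_cast Finset.mem_range.1 hi
      rw [min_eq_right (by linarith), max_eq_right zero_le_one, mul_one]
    · rw [add_sub_cancel_left, min_eq_left h1, max_eq_right h0, mul_comm]
  · intro i _ hi
    have h2 : (j : ℝ) + 1 ≤ i := by
      exact_mod_cast not_lt.1 fun h => hi (Finset.mem_range.2 h)
    rw [min_eq_left (by linarith), max_eq_left (by linarith), mul_zero]

theorem exists_isInducedCircleMap (φ : LoopGraph.Homs (LoopGraph.cycle m) (LoopGraph.complete 3))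
    {α : ℤ} (hα : 3 * α = windingSum φ.1) : HasWindingNumber φ α := by
  have hφ : ∀ x, φ.1 x ≠ φ.1 (x + 1) := fun x => φ.2 x (x + 1) (Or.inl rfl)
  have hm : (m : ℝ) ≠ 0 := Nat.cast_ne_zero.2 (NeZero.ne m)
  have hm' : 0 < m := Nat.pos_of_ne_zero (NeZero.ne m)
  let d : ℕ → ℝ := fun i => (triStep (φ.1 (i : ZMod m)) (φ.1 (i + 1)) : ℤ)
  let F₀ : ℝ → ℝ := piecewiseAffine m (φ.1 0).val d
  -- Removing the linear part gives equal values at `0` and `1`. So `h` descends to the circle, and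
  -- adding back `α • z` there gives the circle map.
  let h : ℝ → ℝ := fun y => F₀ y - α * y
  have hd : ((φ.1 0).val : ℝ) + ∑ i ∈ Finset.range m, d i = (φ.1 0).val + 3 * α := by
    have h1 : ((windingSum φ.1 : ℤ) : ℝ) = 3 * α := by exact_mod_cast hα.symm
    rw [← h1]
    unfold windingSum
    rw [sum_zmod_eq_sum_range (fun x => triStep (φ.1 x) (φ.1 (x + 1)))]
    push_cast
    rfl
  have hF0 : F₀ 0 = (φ.1 0).val / 3 := by
    have := piecewiseAffine_apply (φ.1 0).val d hm' le_rfl zero_le_one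
    simpa using this
  have hF1 : F₀ 1 = (φ.1 0).val / 3 + α := by
    obtain ⟨n, hn⟩ := Nat.exists_eq_succ_of_ne_zero (NeZero.ne m)
    have h1 := piecewiseAffine_apply (φ.1 0).val d (show n < m by omega) zero_le_one le_rfl
    rw [one_mul, add_assoc, ← Finset.sum_range_succ, ← Nat.succ_eq_add_one, ← hn, hd,
      show ((n : ℝ) + 1) / m = 1 by rw [div_eq_one_iff_eq hm, hn]; push_cast; ring] at h1
    change piecewiseAffine m (φ.1 0).val d 1 = _
    rw [h1]
    ring
  have hh : h 0 = h (0 + 1) := by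
    simp only [h, zero_add, hF0, hF1]
    ring
  have hc : Continuous h := by
    have := continuous_piecewiseAffine (m := m) (φ.1 0).val d
    fun_prop
  let G : UnitAddCircle → ℝ := AddCircle.liftIco 1 0 h
  have hG : Continuous G := AddCircle.liftIco_continuous hh hc.continuousOn
  have hGh : ∀ y : ℝ, 0 ≤ y → y ≤ 1 → G (y : UnitAddCircle) = h y := by
    intro y h0 h1
    rcases h1.lt_or_eq with h1 | rfl
    · exact AddCircle.liftIco_coe_apply ⟨h0, by rwa [zero_add]⟩
    · have h2 : G ((0 : ℝ) : UnitAddCircle) = h 0 :=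
        AddCircle.liftIco_coe_apply ⟨le_rfl, by simp⟩
      rw [zero_add] at hh
      rw [AddCircle.coe_period, ← AddCircle.coe_zero, h2, hh]
  have hcoe : ∀ n : ℤ, ((n : ℝ) : UnitAddCircle) = 0 := fun n =>
    (AddCircle.coe_eq_zero_iff 1).2 ⟨n, by simp⟩
  have hf : Continuous fun z : UnitAddCircle => (G z : UnitAddCircle) + α • z :=
    ((AddCircle.continuous_mk' 1).comp hG).add (continuous_zsmul α)
  have hF : Continuous fun x : ℝ => G (x : UnitAddCircle) + α * x :=
    (hG.comp (AddCircle.continuous_mk' 1)).add (continuous_const.mul continuous_id)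
  refine ⟨⟨_, hf⟩, ?_, ⟨_, hF⟩, fun x => ?_, fun x => ?_⟩
  · intro i t h0 h1
    obtain ⟨j, hj⟩ := Int.eq_ofNat_of_zero_le 
      (Int.emod_nonneg i (by exact_mod_cast hm'.ne' : (m : ℤ) ≠ 0))
    have hjm : j < m := by
      have := Int.emod_lt_of_pos i (by exact_mod_cast hm' : (0 : ℤ) < m)
      rw [hj] at this
      exact_mod_cast this
    have hi : (i : ZMod m) = (j : ZMod m) := by
      rw [← Int.cast_natCast (R := ZMod m) j, ZMod.intCast_eq_intCast_iff]
      rw [← Int.ofNat_eq_natCast, ← hj]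
      exact (Int.mod_modEq i m).symm
    have hi2 : ((i : ℝ) + t) / m = ((i / (m : ℤ) : ℤ) : ℝ) + (j + t) / m := by
      have h2 : (i : ℝ) = m * ((i / (m : ℤ) : ℤ) : ℝ) + j := by
        have := Int.mul_ediv_add_emod i m
        rw [hj] at this
        exact_mod_cast this.symm
      rw [h2]
      field_simp
      ring
    rw [hi2, AddCircle.coe_add, hcoe, zero_add, hi, ← cast_triStep]
    have hj1 : ((j : ℝ) + t) / m ≤ 1 := by
      rw [div_le_one (by exact_mod_cast hm')]
      have : (j : ℝ) + 1 ≤ m := by exact_mod_cast hjm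
      linarith
    rw [ContinuousMap.coe_mk, hGh _ (by positivity) hj1, ← AddCircle.coe_zsmul, ← AddCircle.coe_add]
    simp only [h, zsmul_eq_mul, sub_add_cancel, F₀]
    rw [piecewiseAffine_apply _ d hjm h0 h1]
    obtain ⟨k, hk⟩ := val_add_sum_triStep φ.1 hφ j
    have hk' : ((φ.1 0).val : ℝ) + ∑ i ∈ Finset.range j, d i = (φ.1 (j : ZMod m)).val + 3 * k := by
      have h2 := congrArg (Int.cast : ℤ → ℝ) hk
      simp only [Int.cast_add, Int.cast_sum, Int.cast_mul, Int.cast_natCast, Int.cast_ofNat] at h2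
      exact h2
    rw [hk', show ((φ.1 (j : ZMod m)).val + 3 * k + t * d j : ℝ) / 3 =
      ((φ.1 (j : ZMod m)).val + t * d j) / 3 + k by ring, AddCircle.coe_add, hcoe, add_zero]
  · rw [ContinuousMap.coe_mk, ContinuousMap.coe_mk, AddCircle.coe_add, ← zsmul_eq_mul,
      AddCircle.coe_zsmul]
  · simp only [ContinuousMap.coe_mk]
    rw [AddCircle.coe_add, AddCircle.coe_period, add_zero]
    ring

theorem hasWindingNumber_iff (φ : LoopGraph.Homs (LoopGraph.cycle m) (LoopGraph.complete 3))
    (α : ℤ) : HasWindingNumber φ α ↔ HomComplex.windingNumber id (HomComplex.vertex φ) = α := by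
  rw [HomComplex.windingNumber_vertex]
  have h3 := three_dvd_windingSum φ.1 fun x => φ.2 x (x + 1) (Or.inl rfl)
  constructor
  · rintro ⟨f, hf, hα⟩
    have h := three_mul_eq_windingSum_of_isWindingNumber hf hα
    omega
  · rintro rfl
    exact exists_isInducedCircleMap φ (Int.mul_ediv_cancel' h3)

end CircleMaps

/-! ### Homotopy invariance of the first cohomology group -/

namespace SingularCohomology

variable {X Y Z : Type*} [TopologicalSpace X] [TopologicalSpace Y] [TopologicalSpace Z]

theorem H1map_comp (f : C(X, Y)) (g : C(Y, Z)) (z : H1 Z) :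
    H1map (g.comp f) z = H1map f (H1map g z) := by
  obtain ⟨u, rfl⟩ := Submodule.Quotient.mk_surjective _ z
  rfl

theorem H1map_id (z : H1 X) : H1map (ContinuousMap.id X) z = z := by
  obtain ⟨u, rfl⟩ := Submodule.Quotient.mk_surjective _ z
  rfl

theorem coboundary_one_apply {u : Cochain 1 X} (hu : u ∈ LinearMap.ker (coboundary 1 X))
    (σ : Simplex 2 X) : u (face 0 σ) + u (face 1 σ) + u (face 2 σ) = 0 := by
  have h := congrFun (LinearMap.mem_ker.1 hu) σ
  rw [← Fin.sum_univ_three (fun i => u (face i σ))]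
  exact h

/-- All faces of a constant 2-simplex agree, so a cocycle takes a value `a` with `3 * a = 0` on the
constant 1-simplex, and this is `0` modulo 2. -/
theorem H1map_const (y : Y) (z : H1 Y) : H1map (ContinuousMap.const X y) z = 0 := by
  obtain ⟨⟨u, hu⟩, rfl⟩ := Submodule.Quotient.mk_surjective _ z
  refine (Submodule.Quotient.mk_eq_zero _).2 ⟨0, ?_⟩
  rw [map_zero]
  funext σ
  have h := coboundary_one_apply hu (ContinuousMap.const _ y)
  have key : ∀ a : ZMod 2, a + a + a = 0 → 0 = a := by decide
  exact key _ h

/-- The second barycentric coordinate of a point of the standard `1`-simplex. -/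
def simplexTime (s : stdSimplex ℝ (Fin 2)) : unitInterval :=
  ⟨s.1 1, s.2.1 1, by
    have h := s.2.2
    rw [Fin.sum_univ_two] at h
    linarith [s.2.1 0]⟩

theorem continuous_simplexTime : Continuous simplexTime :=
  ((continuous_apply 1).comp continuous_subtype_val).subtype_mk _

theorem simplexTime_map_zero {n : ℕ} (s : stdSimplex ℝ (Fin n)) :
    simplexTime (stdSimplex.map (fun _ => 0) s) = 0 := by
  refine Subtype.ext ?_
  refine (congrFun (stdSimplex.map_coe _ s) 1).trans ?_
  simp [FunOnFinite.linearMap_apply_apply]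

theorem simplexTime_map_one {n : ℕ} (s : stdSimplex ℝ (Fin n)) :
    simplexTime (stdSimplex.map (fun _ => 1) s) = 1 := by
  refine Subtype.ext ?_
  refine (congrFun (stdSimplex.map_coe _ s) 1).trans ?_
  simp [FunOnFinite.linearMap_apply_apply]

/-- The singular simplex that is obtained from a homotopy, a singular simplex `σ` and a simplicial
map with components `t` and `v` to the product of the interval and the domain of `σ`. -/
def prism (H : C(unitInterval × X, Y)) {n k : ℕ} (t : Fin (n + 1) → Fin 2)
    (v : Fin (n + 1) → Fin (k + 1)) (σ : Simplex k X) : Simplex n Y :=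
  ⟨fun s => H (simplexTime (stdSimplex.map t s), σ (stdSimplex.map v s)), by
    have h1 := continuous_simplexTime.comp (stdSimplex.continuous_map (S := ℝ) t)
    have h2 := σ.continuous.comp (stdSimplex.continuous_map (S := ℝ) v)
    exact H.continuous.comp (h1.prodMk h2)⟩

theorem face_prism (H : C(unitInterval × X, Y)) {n k : ℕ} (t : Fin (n + 2) → Fin 2)
    (v : Fin (n + 2) → Fin (k + 1)) (σ : Simplex k X) (i : Fin (n + 2)) :
    face i (prism H t v σ) = prism H (t ∘ i.succAbove) (v ∘ i.succAbove) σ := by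
  ext s
  change H (simplexTime (stdSimplex.map t (stdSimplex.map _ s)), σ (stdSimplex.map v
    (stdSimplex.map _ s))) = H (simplexTime (stdSimplex.map (t ∘ i.succAbove) s),
      σ (stdSimplex.map (v ∘ i.succAbove) s))
  rw [← stdSimplex.map_comp_apply, ← stdSimplex.map_comp_apply]

theorem prism_face (H : C(unitInterval × X, Y)) {n k : ℕ} (t : Fin (n + 1) → Fin 2)
    (v : Fin (n + 1) → Fin (k + 1)) (σ : Simplex (k + 1) X) (i : Fin (k + 2)) :
    prism H t v (face i σ) = prism H t (i.succAbove ∘ v) σ := by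
  ext s
  change H (_, σ (stdSimplex.map _ (stdSimplex.map v s))) =
    H (_, σ (stdSimplex.map (i.succAbove ∘ v) s))
  rw [← stdSimplex.map_comp_apply]

/-- The square swept out by a 1-simplex is cut into two triangles along its diagonal. Adding the two
cocycle relations cancels the diagonal and leaves `f`, `g` and the tracks of the end points; the
values of `u` on tracks form the required 0-cochain. -/
theorem H1map_eq_of_homotopy {f g : C(X, Y)} (H : f.Homotopy g) (z : H1 Y) :
    H1map f z = H1map g z := by
  obtain ⟨⟨u, hu⟩, rfl⟩ := Submodule.Quotient.mk_surjective _ z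
  refine (Submodule.Quotient.eq _).2
    ⟨fun σ => u (prism H.toContinuousMap id (fun _ => 0) σ), ?_⟩
  funext σ
  change ∑ i : Fin 2, u (prism H.toContinuousMap id (fun _ => 0) (face i σ)) =
    u (f.comp σ) - u (g.comp σ)
  have h1 := coboundary_one_apply hu (prism H.toContinuousMap ![0, 0, 1] ![0, 1, 1] σ)
  have h2 := coboundary_one_apply hu (prism H.toContinuousMap ![0, 1, 1] ![0, 0, 1] σ)
  have hf : prism H.toContinuousMap (fun _ => 0) id σ = f.comp σ := by
    ext s
    change H (simplexTime (stdSimplex.map (fun _ => 0) s), σ (stdSimplex.map id s)) = f (σ s)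
    rw [simplexTime_map_zero, stdSimplex.map_id_apply, H.apply_zero]
  have hg : prism H.toContinuousMap (fun _ => 1) id σ = g.comp σ := by
    ext s
    change H (simplexTime (stdSimplex.map (fun _ => 1) s), σ (stdSimplex.map id s)) = g (σ s)
    rw [simplexTime_map_one, stdSimplex.map_id_apply, H.apply_one]
  rw [Fin.sum_univ_two, prism_face, prism_face]
  simp only [face_prism] at h1 h2
  rw [show (![0, 0, 1] ∘ Fin.succAbove 0 : Fin 2 → Fin 2) = id by decide,
    show (![0, 1, 1] ∘ Fin.succAbove 0 : Fin 2 → Fin 2) = fun _ => 1 by decide,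
    show (![0, 0, 1] ∘ Fin.succAbove 1 : Fin 2 → Fin 2) = id by decide,
    show (![0, 1, 1] ∘ Fin.succAbove 1 : Fin 2 → Fin 2) = id by decide,
    show (![0, 0, 1] ∘ Fin.succAbove 2 : Fin 2 → Fin 2) = fun _ => 0 by decide,
    show (![0, 1, 1] ∘ Fin.succAbove 2 : Fin 2 → Fin 2) = id by decide, hf] at h1
  rw [show (![0, 0, 1] ∘ Fin.succAbove 0 : Fin 2 → Fin 2) = id by decide,
    show (![0, 1, 1] ∘ Fin.succAbove 0 : Fin 2 → Fin 2) = fun _ => 1 by decide,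
    show (![0, 0, 1] ∘ Fin.succAbove 1 : Fin 2 → Fin 2) = id by decide,
    show (![0, 1, 1] ∘ Fin.succAbove 1 : Fin 2 → Fin 2) = id by decide,
    show (![0, 0, 1] ∘ Fin.succAbove 2 : Fin 2 → Fin 2) = fun _ => 0 by decide,
    show (![0, 1, 1] ∘ Fin.succAbove 2 : Fin 2 → Fin 2) = id by decide, hg] at h2
  rw [show (Fin.succAbove 0 ∘ (fun _ => 0 : Fin 2 → Fin 1) : Fin 2 → Fin 2) = fun _ => 1 by decide,
    show (Fin.succAbove 1 ∘ (fun _ => 0 : Fin 2 → Fin 1) : Fin 2 → Fin 2) = fun _ => 0 by decide]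
  have key : ∀ a b c d e : ZMod 2, a + b + c = 0 → d + b + e = 0 → a + e = c - d := by decide
  exact key _ _ _ _ _ h1 h2

end SingularCohomology

/-! ### The infinite dimensional sphere is acyclic -/

namespace InfSphere

theorem sum_sq_pos {v : ℕ →₀ ℝ} (hv : v ≠ 0) : 0 < v.sum fun _ t => t ^ 2 :=
  Finset.sum_pos (fun _ hi => sq_pos_of_ne_zero (Finsupp.mem_support_iff.1 hi))
    (Finsupp.support_nonempty_iff.2 hv)

/-- The radial projection to the sphere. -/
def normalize (v : ℕ →₀ ℝ) (hv : v ≠ 0) : InfSphere :=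
  ⟨(√(v.sum fun _ t => t ^ 2))⁻¹ • v, by
    rw [Finsupp.sum_smul_index' (fun _ => by simp)]
    simp only [smul_eq_mul, mul_pow]
    rw [← Finsupp.mul_sum, inv_pow, Real.sq_sqrt (sum_sq_pos hv).le,
      inv_mul_cancel₀ (sum_sq_pos hv).ne']⟩

theorem normalize_apply (v : ℕ →₀ ℝ) (hv : v ≠ 0) (i : ℕ) :
    (normalize v hv).1 i = (√(v.sum fun _ t => t ^ 2))⁻¹ * v i := rfl

theorem ne_zero (x : InfSphere) : x.1 ≠ 0 := by
  intro h
  have h1 := x.2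
  rw [h] at h1
  simp at h1

theorem normalize_eq (x : InfSphere) {v : ℕ →₀ ℝ} (hv : v ≠ 0) (h : v = x.1) :
    normalize v hv = x := by
  subst h
  refine Subtype.ext ?_
  change (√(x.1.sum fun _ t => t ^ 2))⁻¹ • x.1 = x.1
  rw [x.2, Real.sqrt_one, inv_one, one_smul]

theorem exists_mem_subsphere (x : InfSphere) : ∃ n, x ∈ subsphere n := by
  refine ⟨x.1.support.sup id + 1, fun i hi => ?_⟩
  by_contra h
  have := Finset.le_sup (f := id) (Finsupp.mem_support_iff.2 h)
  simp only [id] at this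
  omega

theorem continuous_normalize_of_mem_subsphere {Z : Type*} [TopologicalSpace Z] {n : ℕ}
    (K : Z → ℕ →₀ ℝ) (hK : ∀ z, K z ≠ 0) (hn : ∀ z i, n ≤ i → K z i = 0)
    (hc : ∀ i, Continuous fun z => K z i) : Continuous fun z => normalize (K z) (hK z) := by
  refine continuous_weakTopology_of_mem_cell _ _ n _ (fun z i hi => ?_) ?_
  · rw [normalize_apply, hn z i hi, mul_zero]
  · refine continuous_pi fun i => ?_
    have hs : ∀ z, ((K z).sum fun _ t => t ^ 2) = ∑ j ∈ Finset.range n, K z j ^ 2 := by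
      intro z
      refine Finsupp.sum_of_support_subset _ (fun j hj => ?_) _ (by simp)
      by_contra h
      exact Finsupp.mem_support_iff.1 hj (hn z j (not_lt.1 fun h' => h (Finset.mem_range.2 h')))
    have he : (fun z => coord (normalize (K z) (hK z)) i) =
        fun z => (√(∑ j ∈ Finset.range n, K z j ^ 2))⁻¹ * K z i := by
      funext z
      rw [← hs]
      exact normalize_apply _ _ i
    rw [he]
    refine Continuous.mul (Continuous.inv₀ ?_ fun z => ?_) (hc i)
    · exact (continuous_finsetSum _ fun j _ => (hc j).pow 2).sqrt
    · rw [← hs]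
      exact (Real.sqrt_pos.2 (sum_sq_pos (hK _))).ne'

/-- The product with the interval need not obviously carry the weak topology. Currying into the
compact-open topology on paths allows the test on subspheres, and local compactness of the interval
allows uncurrying. -/
theorem continuous_of_continuous_on_subspheres {Y : Type*} [TopologicalSpace Y]
    (g : unitInterval × InfSphere → Y)
    (hg : ∀ (Z : Type) [TopologicalSpace Z] (n : ℕ) (a : Z → InfSphere) (b : Z → unitInterval),
      (∀ z, a z ∈ subsphere n) → Continuous (fun z => coord (a z)) → Continuous b →
      Continuous fun z => g (b z, a z)) : Continuous g := by
  have hx : ∀ x, Continuous fun t => g (t, x) := fun x => by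
    obtain ⟨n, hn⟩ := exists_mem_subsphere x
    exact hg unitInterval n (fun _ => x) id (fun _ => hn) continuous_const continuous_id
  let Φ : InfSphere → C(unitInterval, Y) := fun x => ⟨fun t => g (t, x), hx x⟩
  have hΦ : Continuous Φ := by
    refine continuous_weakTopology_dom _ _ _ fun n => ?_
    let _ : TopologicalSpace (subsphere n) :=
      TopologicalSpace.induced (fun p : subsphere n => coord p) inferInstance
    have hc : Continuous (fun p : subsphere n => coord p) := continuous_induced_dom
    refine ContinuousMap.continuous_of_continuous_uncurry _ ?_
    exact hg (subsphere n × unitInterval) n (fun z => z.1) (fun z => z.2) (fun z => z.1.2)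
      (hc.comp continuous_fst) continuous_snd
  have h : Continuous fun z : InfSphere × unitInterval => Φ z.1 z.2 :=
    ContinuousMap.continuous_uncurry_of_continuous ⟨Φ, hΦ⟩
  exact h.comp continuous_swap

theorem continuous_normalize (K : unitInterval → InfSphere → ℕ →₀ ℝ) (hK : ∀ t x, K t x ≠ 0)
    (hfin : ∀ n, ∃ n', ∀ t, ∀ x ∈ subsphere n, ∀ i, n' ≤ i → K t x i = 0)
    (k : ℕ → unitInterval × (ℕ → ℝ) → ℝ) (hk : ∀ i, Continuous (k i))
    (hKk : ∀ t x i, K t x i = k i (t, coord x)) :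
    Continuous fun z : unitInterval × InfSphere => normalize (K z.1 z.2) (hK z.1 z.2) := by
  refine continuous_of_continuous_on_subspheres _ fun Z _ n a b ha hac hb => ?_
  obtain ⟨n', hn'⟩ := hfin n
  refine continuous_normalize_of_mem_subsphere (n := n') (fun z => K (b z) (a z))
    (fun z => hK (b z) (a z)) (fun z => hn' (b z) (a z) (ha z)) fun i => ?_
  simp only [hKk]
  exact (hk i).comp (hb.prodMk hac)

/-- The shift of coordinates. -/
def shift (v : ℕ →₀ ℝ) : ℕ →₀ ℝ := v.mapDomain Nat.succ

theorem shift_zero (v : ℕ →₀ ℝ) : shift v 0 = 0 :=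
  Finsupp.mapDomain_of_notMem_range _ _ (by simp)

theorem shift_succ (v : ℕ →₀ ℝ) (i : ℕ) : shift v (i + 1) = v i :=
  Finsupp.mapDomain_apply Nat.succ_injective _ _

/-- The linear homotopy from the identity to the shift. -/
def shiftHomotopy (t : unitInterval) (x : InfSphere) : ℕ →₀ ℝ :=
  (1 - t : ℝ) • x.1 + (t : ℝ) • shift x.1

/-- The linear homotopy from the shift to a constant map. -/
def contraction (t : unitInterval) (x : InfSphere) : ℕ →₀ ℝ :=
  (1 - t : ℝ) • shift x.1 + (t : ℝ) • Finsupp.single 0 1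

/-- At `t = 1` the shift is injective; for `t < 1` the coordinates of `x` would vanish one after the
other from index `0` on. -/
theorem shiftHomotopy_ne_zero (t : unitInterval) (x : InfSphere) : shiftHomotopy t x ≠ 0 := by
  intro h
  refine ne_zero x (Finsupp.ext fun i => ?_)
  have h0 : (1 - t : ℝ) * x.1 0 = 0 := by
    simpa [shiftHomotopy, shift_zero] using DFunLike.congr_fun h 0
  have h1 : ∀ i, (1 - t : ℝ) * x.1 (i + 1) + t * x.1 i = 0 := fun i => by
    simpa [shiftHomotopy, shift_succ] using DFunLike.congr_fun h (i + 1)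
  by_cases ht : (1 - t : ℝ) = 0
  · have h2 := h1 i
    rw [ht, zero_mul, zero_add, show (t : ℝ) = 1 by linarith, one_mul] at h2
    exact h2
  · induction i with
    | zero => exact (mul_eq_zero.1 h0).resolve_left ht
    | succ i ih =>
      have h2 := h1 i
      rw [ih, Finsupp.zero_apply, mul_zero, add_zero] at h2
      exact (mul_eq_zero.1 h2).resolve_left ht

theorem contraction_ne_zero (t : unitInterval) (x : InfSphere) : contraction t x ≠ 0 := by
  intro h
  have h0 : (t : ℝ) = 0 := by
    simpa [contraction, shift_zero] using DFunLike.congr_fun h 0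
  refine ne_zero x (Finsupp.ext fun i => ?_)
  simpa [contraction, shift_succ, h0] using DFunLike.congr_fun h (i + 1)

theorem continuous_normalize_shiftHomotopy : Continuous fun z : unitInterval × InfSphere =>
    normalize (shiftHomotopy z.1 z.2) (shiftHomotopy_ne_zero z.1 z.2) := by
  refine continuous_normalize _ _ (fun n => ⟨n + 1, fun t x hx i hi => ?_⟩)
    (fun i z => (1 - z.1 : ℝ) * z.2 i + z.1 * Nat.casesOn i 0 z.2) (fun i => ?_) fun t x i => ?_
  · obtain ⟨i, rfl⟩ := Nat.exists_eq_add_of_le' (show 1 ≤ i by omega)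
    simp [shiftHomotopy, shift_succ, hx i (by omega), hx (i + 1) (by omega)]
  · cases i <;> simp only <;> fun_prop
  · cases i <;> simp [shiftHomotopy, shift_zero, shift_succ, coord]

theorem continuous_normalize_contraction : Continuous fun z : unitInterval × InfSphere =>
    normalize (contraction z.1 z.2) (contraction_ne_zero z.1 z.2) := by
  refine continuous_normalize _ _ (fun n => ⟨n + 1, fun t x hx i hi => ?_⟩)
    (fun i z => Nat.casesOn i (z.1 : ℝ) fun j => (1 - z.1 : ℝ) * z.2 j) (fun i => ?_)
    fun t x i => ?_
  · obtain ⟨i, rfl⟩ := Nat.exists_eq_add_of_le' (show 1 ≤ i by omega)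
    simp [contraction, shift_succ, hx i (by omega)]
  · cases i <;> simp only <;> fun_prop
  · cases i <;> simp [contraction, shift_zero, shift_succ, coord]

-- The identity is homotopic to the shift, whose image has vanishing coordinate `0` and can
-- therefore be contracted linearly to the basis vector `e`.
open SingularCohomology in
theorem H1_eq_zero (z : H1 InfSphere) : z = 0 := by
  let A : C(unitInterval × InfSphere, InfSphere) := ⟨_, continuous_normalize_shiftHomotopy⟩
  let B : C(unitInterval × InfSphere, InfSphere) := ⟨_, continuous_normalize_contraction⟩
  let S : C(InfSphere, InfSphere) := A.comp ⟨fun x => (1, x), by fun_prop⟩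
  let e : InfSphere := ⟨Finsupp.single 0 1, by simp⟩
  have hA : (ContinuousMap.id InfSphere).Homotopy S :=
    ⟨A, fun x => normalize_eq x (shiftHomotopy_ne_zero 0 x) (by simp [shiftHomotopy]), fun _ => rfl⟩
  have hB : S.Homotopy (ContinuousMap.const InfSphere e) := by
    refine ⟨B, fun x => ?_, fun x =>
      normalize_eq e (contraction_ne_zero 1 x) (by simp [contraction, e])⟩
    change normalize (contraction 0 x) (contraction_ne_zero 0 x) =
      normalize (shiftHomotopy 1 x) (shiftHomotopy_ne_zero 1 x)
    congr 1
    simp [contraction, shiftHomotopy]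
  rw [← H1map_id z, H1map_eq_of_homotopy hA, H1map_eq_of_homotopy hB, H1map_const]

end InfSphere

/-! ### Vanishing of the first Stiefel-Whitney class -/

namespace FreeInvolution

variable {X : Type*} [TopologicalSpace X]

/-- The projection to the orbit space. -/
def orbitMap (τ : FreeInvolution X) : C(X, τ.OrbitSpace) :=
  ⟨Quotient.mk τ.orbitSetoid, continuous_quot_mk⟩

/-- Each orbit has exactly one point with `W > 0`, and these points form a clopen set; `g` evaluates
`f` at that point. -/
theorem exists_lift_onOrbits {Y : Type*} [TopologicalSpace Y] {τ : FreeInvolution X}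
    {ρ : FreeInvolution Y} (f : EquivariantMap τ ρ) {W : X → ℤ} (hW : Continuous W)
    (hneg : ∀ x, W (τ.toFun x) = -W x) (h0 : ∀ x, W x ≠ 0) :
    ∃ g : C(τ.OrbitSpace, Y), f.onOrbits = ρ.orbitMap.comp g := by
  have hopen : IsClopen {x | 0 < W x} :=
    (isClopen_discrete {n : ℤ | 0 < n}).preimage hW
  let g : X → Y := fun x => if 0 < W x then f.1 x else f.1 (τ.toFun x)
  have hg : Continuous g := by
    refine continuous_if (fun x hx => ?_) f.1.continuous.continuousOn
      (f.1.continuous.comp τ.continuous).continuousOn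
    rw [hopen.frontier_eq] at hx
    exact hx.elim
  have hinv : ∀ x, g (τ.toFun x) = g x := by
    intro x
    simp only [g, hneg, τ.involutive]
    have := h0 x
    split_ifs
    · omega
    · rfl
    · rfl
    · omega
  refine ⟨⟨Quotient.lift (s := τ.orbitSetoid) g ?_, hg.quotient_lift _⟩, ?_⟩
  · rintro x y (rfl | rfl)
    · rfl
    · exact (hinv x).symm
  · ext z
    obtain ⟨x, rfl⟩ := Quotient.exists_rep z
    change Quotient.mk ρ.orbitSetoid (f.1 x) = Quotient.mk ρ.orbitSetoid (g x)
    refine Quotient.sound ?_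
    simp only [g]
    split_ifs
    · exact Or.inl rfl
    · exact Or.inr (f.2 x)

end FreeInvolution

/-- The pull-back passes through the first cohomology of the infinite sphere, whichever equivariant
map and whichever class were chosen. -/
theorem stiefelWhitney_eq_zero {X : Type*} [TopologicalSpace X] (τ : FreeInvolution X) {W : X → ℤ}
    (hW : Continuous W) (hneg : ∀ x, W (τ.toFun x) = -W x) (h0 : ∀ x, W x ≠ 0) :
    stiefelWhitney τ = 0 := by
  unfold stiefelWhitney
  split_ifs with h
  · obtain ⟨g, hg⟩ := FreeInvolution.exists_lift_onOrbits (Classical.choice h) hW hneg h0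
    rw [hg, SingularCohomology.H1map_comp, InfSphere.H1_eq_zero (SingularCohomology.H1map _ _),
      map_zero]
  -- Without an equivariant map the class is `0` by convention.
  · rfl

/-- The sign of `W` is an equivariant map to a pair of antipodal points. -/
theorem nonempty_equivariantMap_antipodal {X : Type*} [TopologicalSpace X] (τ : FreeInvolution X)
    {W : X → ℤ} (hW : Continuous W) (hneg : ∀ x, W (τ.toFun x) = -W x) (h0 : ∀ x, W x ≠ 0) :
    Nonempty (FreeInvolution.EquivariantMap τ InfSphere.antipodal) := by
  let e : InfSphere := ⟨Finsupp.single 0 1, by simp⟩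
  let s : ℤ → InfSphere := fun n => if 0 < n then e else InfSphere.antipodal.toFun e
  refine ⟨⟨⟨fun x => s (W x), (continuous_of_discreteTopology (f := s)).comp hW⟩, fun x => ?_⟩⟩
  change s (W (τ.toFun x)) = InfSphere.antipodal.toFun (s (W x))
  have := h0 x
  simp only [s, hneg]
  split_ifs
  · omega
  · exact (InfSphere.antipodal.involutive e).symm
  · rfl
  · omega

/-! ### Three-colourings and the proof of the theorem -/

theorem LoopGraph.exists_coloring_of_chromaticNumber_lt {V : Type*} {G : LoopGraph V}
    (h : ¬ 4 ≤ G.chromaticNumber) :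
    ∃ f : V → Fin 3, ∀ a b, G.Adj a b → f a ≠ f b := by
  by_contra hc
  refine h (le_iInf₂ fun n hn => ?_)
  obtain ⟨f, hf⟩ := hn
  by_contra h4
  have hn : n ≤ 3 := by
    have : n < 4 := by exact_mod_cast not_le.1 h4
    omega
  exact hc ⟨fun a => Fin.castLE hn (f a), fun a b hab he =>
    hf a b hab (Fin.castLE_injective hn he)⟩

/-- For `|α| = 2 * k + 1` both bounds say `3 * k + 1 ≤ r`. -/
theorem setOf_odd_abs_le (r : ℕ) (hr : 1 ≤ r) :
    {α : ℤ | Odd α ∧ 3 * |α| ≤ ((2 * r + 1 : ℕ) : ℤ)} =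
      {α : ℤ | Odd α ∧ |α| ≤ 2 * (((r - 1) / 3 : ℕ) : ℤ) + 1} := by
  ext α
  refine and_congr_right fun hα => ?_
  obtain ⟨k, hk⟩ := odd_abs.2 hα
  omega

theorem mainTheorem4 (r : ℕ) (hr : 1 ≤ r) (c : ZMod (2 * r + 1)) :
    -- the connected components of `Hom(C_{2r+1}, K_3)` and the winding numbers
    (∃ W : HomComplex (LoopGraph.cycle (2 * r + 1)) (LoopGraph.complete 3) → ℤ,
      Continuous W ∧
      (∀ φ α, HasWindingNumber φ α ↔ W (HomComplex.vertex φ) = α) ∧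
      Set.range W = {α : ℤ | Odd α ∧ |α| ≤ 2 * (((r - 1) / 3 : ℕ) : ℤ) + 1} ∧
      (∀ x, 3 * |W x| < 2 * (r : ℤ) + 1 → connectedComponent x = W ⁻¹' {W x}) ∧
      (∀ α : ℤ, 3 * |α| = 2 * (r : ℤ) + 1 → (W ⁻¹' {α}).ncard = 3 ∧
        ∀ x ∈ W ⁻¹' {α}, connectedComponent x = {x}) ∧
      (∀ x, W ((HomComplex.reflection r c (LoopGraph.complete_loopless 3)).toFun x) = - W x)) ∧
    -- no connected component is preserved by the action
    (∀ x : HomComplex (LoopGraph.cycle (2 * r + 1)) (LoopGraph.complete 3),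
      Disjoint
        ((HomComplex.reflection r c (LoopGraph.complete_loopless 3)).toFun ''
          connectedComponent x)
        (connectedComponent x)) ∧
    -- the Stiefel-Whitney class of `Hom(C_{2r+1}, K_3)` vanishes
    (Nonempty (FreeInvolution.EquivariantMap
        (HomComplex.reflection r c (LoopGraph.complete_loopless 3)) InfSphere.antipodal) ∧
      stiefelWhitney (HomComplex.reflection r c (LoopGraph.complete_loopless 3)) = 0) ∧
    -- the two lower bounds for the chromatic number
    (∀ (V : Type*) (G : LoopGraph V) (hG : G.Loopless),
      stiefelWhitney (HomComplex.reflection r c hG) ≠ 0 → 4 ≤ G.chromaticNumber) ∧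
    (∀ (V : Type*) (G : LoopGraph V),
      ConnectedSpace (HomComplex (LoopGraph.cycle (2 * r + 1)) G) → 4 ≤ G.chromaticNumber) := by
  have hm : Odd (2 * r + 1) := ⟨r, rfl⟩
  have hm1 : 1 < 2 * r + 1 := by omega
  have hid := HomComplex.id_coloring 3
  have hcast : ((2 * r + 1 : ℕ) : ℤ) = 2 * (r : ℤ) + 1 := by push_cast; ring
  have hodd : ∀ {α : ℤ}, Odd α → α ≠ 0 ∧ α ≠ -α := by
    rintro _ ⟨k, rfl⟩
    omega
  have hneg := HomComplex.windingNumber_reflection (c := c) (LoopGraph.complete_loopless 3) hid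
  have hne : ∀ x : HomComplex (LoopGraph.cycle (2 * r + 1)) (LoopGraph.complete 3),
      HomComplex.windingNumber id x ≠ 0 := fun x =>
    (hodd (HomComplex.odd_windingNumber hm hid x)).1
  refine ⟨⟨HomComplex.windingNumber id, HomComplex.continuous_windingNumber hid,
    hasWindingNumber_iff, ?_, fun x hx => ?_, fun α hα => ⟨?_, fun x hx => ?_⟩, hneg⟩,
    fun x => ?_, ⟨?_, ?_⟩, fun V G hG h => ?_, fun V G hconn => ?_⟩
  · rw [HomComplex.range_windingNumber hm, setOf_odd_abs_le r hr]
  · exact HomComplex.connectedComponent_eq_windingNumber_preimage hm1 x (by rwa [hcast])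
  · exact HomComplex.ncard_windingNumber_preimage hm1 (by rwa [hcast])
  · refine HomComplex.connectedComponent_eq_singleton hm1 x ?_
    rw [hcast, Set.mem_singleton_iff.1 hx, hα]
  · rw [Set.disjoint_left]
    rintro _ ⟨y, hy, rfl⟩ hy'
    have h1 := HomComplex.windingNumber_eq_of_mem_connectedComponent hy
    have h2 := HomComplex.windingNumber_eq_of_mem_connectedComponent hy'
    rw [hneg, h1] at h2
    exact (hodd (HomComplex.odd_windingNumber hm hid x)).2 h2.symm
  · exact nonempty_equivariantMap_antipodal _ (HomComplex.continuous_windingNumber hid) hneg hne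
  · exact stiefelWhitney_eq_zero _ (HomComplex.continuous_windingNumber hid) hneg hne
  · by_contra hlt
    obtain ⟨f, hf⟩ := LoopGraph.exists_coloring_of_chromaticNumber_lt hlt
    exact h (stiefelWhitney_eq_zero _ (HomComplex.continuous_windingNumber hf)
      (HomComplex.windingNumber_reflection hG hf)
      fun x => (hodd (HomComplex.odd_windingNumber hm hf x)).1)
  · by_contra hlt
    obtain ⟨f, hf⟩ := LoopGraph.exists_coloring_of_chromaticNumber_lt hlt
    -- The colouring excludes loops, so the reflection is available. Connectedness makes `W`
    -- constant although the reflection negates its odd value.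
    have hG : G.Loopless := fun x hx => hf x x hx rfl
    obtain ⟨p⟩ := hconn.toNonempty
    have h1 := HomComplex.windingNumber_reflection (c := c) hG hf p
    have h2 := isPreconnected_univ.constant
      (HomComplex.continuous_windingNumber hf).continuousOn
      (Set.mem_univ ((HomComplex.reflection r c hG).toFun p)) (Set.mem_univ p)
    exact (hodd (HomComplex.odd_windingNumber hm hf p)).2 (h2.symm.trans h1)

end
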